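/- **Theorem 6.1.** For every $d\in\{1,2,\dots\}$ let $D_d\subset\mathbb R^d$ be an open set. Assume that either $D_d=(0,1)^d$ for all $d$, or $(D_d)$ is a sequence of sets of small radius, i.e. $\lambda_d(D_d)=1$ for all $d$ and $$\limsup_{d\to\infty}\frac{\operatorname{rad}(D_d)}{\sqrt d}<\sqrt{\frac{2}{\pi e}},\qquad \operatorname{rad}(D)=\inf_{x\in\mathbb R^d}\sup_{y\in D}\|y-x\|_2 .$$ For a double sequence $L=(L_{j,d})_{j\ge0,\,d\ge1}$ of positive numbers let $$C_d^\infty(L)=\Bigl\{f\in C^\infty(D_d)\;:\;\sup_{D_d}|f|\le 1,\ \|f^{(j)}(x)-f^{(j)}(y)\|\le L_{j,d}\|x-y\|_2\ \text{ for all } x,y\in D_d,\ j=0,1,2,\dots\Bigr\},$$ where $f^{(j)}(x)$ is the $j$-th derivative, a $j$-linear form with its operator norm with respect to the Euclidean norm. Let $n(\varepsilon,C_d^\infty(L))$ be the least number $n$ of function values with which some algorithm $f\mapsto\phi(f(x_1),\dots,f(x_n))$ (sample points $x_i\in D_d$ chosen adaptively, $\phi:\mathbb R^n\to\mathbb R$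 arbitrary) approximates $\int_{D_d}f(x)\,dx$ with error at most $\varepsilon$ for all $f\in C_d^\infty(L)$. The curse of dimensionality for $C_d^\infty(L)$ means that there are $c_0,\varepsilon_0,\gamma>0$ such that $n(\varepsilon,C_d^\infty(L))\ge c_0(1+\gamma)^d$ for all $0<\varepsilon\le\varepsilon_0$ and infinitely many $d$. 1. Let $c,\eta>0$. If there are infinitely many $d$ for which $$L_{0,d}\sqrt d\ \ge\ c\qquad\text{and}\qquad L_{j,d}\,d\ \ge\ c\,(j!)^{1+\eta}\ \text{ for all } j\ge1,$$ then the curse of dimensionality holds for $C_d^\infty(L)$. 2. If all $D_d$ are convex and $\lim_{d\to\infty}L_{j,d}\,d^{(j+1)/2}=0$ for some $j\in\{0,1,2,\dots\}$, then the curse of dimensionality does not hold for $C_d^\infty(L)$. 3. If all $D_d$ are convex and there are constants $c<\infty$ and $\delta>0$ such that $$L_{j,d}\le c\,(2-\delta)^j\,j!\,d^{-(j+1)/2}\qquad\text{for all } j,d\ge1,$$ then numerical integration for the classes $C_d^\infty(L)$ is quasi-polynomially tractable: all $n(\varepsilon,C_d^\infty(L))$ are finite and $$\ln n(\varepsilon,C_d^\infty(L))\le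 C\,(1-\ln\varepsilon)(1+\ln d)\qquad\text{for all }\varepsilon\in(0,1),\ d\ge1,$$ with a constant $C<\infty$ that depends only on $c$, $\delta$ and the sequence $(D_d)$. -/

import Mathlib

open MeasureTheory Filter Topology
open scoped ContDiff

noncomputable section

namespace HighDimIntegration

/-- `ℝ^d` with the Euclidean norm. -/
abbrev E (d : ℕ) : Type := EuclideanSpace ℝ (Fin d)

/-- The open unit cube `(0,1)^d`. -/
def unitCube (d : ℕ) : Set (E d) := {x | ∀ i, x i ∈ Set.Ioo (0 : ℝ) 1}

/-- The radius `inf_{x ∈ ℝ^d} sup_{y ∈ D} ‖y - x‖`, with value `∞` if `D` is unbounded. -/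
def radius {d : ℕ} (D : Set (E d)) : ENNReal := ⨅ x : E d, ⨆ y ∈ D, edist y x

/-- `(D_d)` is the sequence of the open unit cubes. -/
def IsCubes (D : (d : ℕ) → Set (E d)) : Prop := ∀ d, 1 ≤ d → D d = unitCube d

/-- `(D_d)` is a sequence of (open) sets of small radius: they have Lebesgue measure one and
`limsup rad(D_d) / √d < √(2 / (π e))`. -/
def IsSmallRadius (D : (d : ℕ) → Set (E d)) : Prop :=
  (∀ d, 1 ≤ d → IsOpen (D d) ∧ volume (D d) = 1) ∧
    limsup (fun d : ℕ => radius (D d) / ENNReal.ofReal (Real.sqrt d)) atTop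
      < ENNReal.ofReal (Real.sqrt (2 / (Real.pi * Real.exp 1)))

/-- The class `C_d^∞(L)` on the open set `D`, for the sequence `L = (L_j)` of bounds in the fixed
dimension `d`: functions that are infinitely differentiable on `D`, bounded by one on `D`, and
whose `j`-th derivative (a `j`-linear form with its operator norm) has on `D` the Lipschitz
constant at most `L_j`, for `j = 0, 1, 2, …`.  A function on `D` is represented by any extension
to `ℝ^d`; only its values on `D` are ever used. -/
def smoothClass {d : ℕ} (D : Set (E d)) (L : ℕ → ℝ) : Set (E d → ℝ) :=
  {f | ContDiffOn ℝ ∞ f D ∧ (∀ x ∈ D, |f x| ≤ 1) ∧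
    ∀ j : ℕ, ∀ x ∈ D, ∀ y ∈ D,
      ‖iteratedFDeriv ℝ j f x - iteratedFDeriv ℝ j f y‖ ≤ L j * ‖x - y‖}

/-- A (deterministic, adaptive) sampling strategy on `D`: the next sample point is chosen from the
list of the function values computed so far, and the output is an arbitrary function of the list
of all computed values. -/
structure Algorithm {d : ℕ} (D : Set (E d)) where
  node : List ℝ → E d
  node_mem : ∀ v, node v ∈ D
  output : List ℝ → ℝ

namespace Algorithm

/-- The list `[f(x₁), …, f(x_n)]` of the first `n` function values computed for the input `f`. -/
def values {d : ℕ} {D : Set (E d)} (A : Algorithm D) (f : E d → ℝ) : ℕ → List ℝ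
  | 0 => []
  | n + 1 => values A f n ++ [f (A.node (values A f n))]

/-- The result `A_n(f) = φ_n(f(x₁), …, f(x_n))` after `n` function evaluations. -/
def apply {d : ℕ} {D : Set (E d)} (A : Algorithm D) (n : ℕ) (f : E d → ℝ) : ℝ :=
  A.output (A.values f n)

/-- The worst case error of `A_n` for the integral over `D` on the class `F`. -/
def error {d : ℕ} {D : Set (E d)} (A : Algorithm D) (n : ℕ) (F : Set (E d → ℝ)) : ENNReal :=
  ⨆ f ∈ F, ENNReal.ofReal |(∫ x in D, f x) - A.apply n f|

end Algorithm

/-- The information complexity `n(ε, F)`: the least `n` such that some algorithm using `n` function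
values has worst case error at most `ε` (and `⊤` if there is no such `n`). -/
def infoComplexity {d : ℕ} (D : Set (E d)) (F : Set (E d → ℝ)) (ε : ℝ) : ℕ∞ :=
  ⨅ (n : ℕ) (_ : ∃ A : Algorithm D, A.error n F ≤ ENNReal.ofReal ε), (n : ℕ∞)

/-- `n(ε, C_d^∞(L))` for the domain `D_d` and the double sequence `L = (L_{j,d})`. -/
def nSmooth (D : (d : ℕ) → Set (E d)) (L : ℕ → ℕ → ℝ) (d : ℕ) (ε : ℝ) : ℕ∞ :=
  infoComplexity (D d) (smoothClass (D d) (fun j => L j d)) ε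

/-- The curse of dimensionality for `C_d^∞(L)`. -/
def Curse (D : (d : ℕ) → Set (E d)) (L : ℕ → ℕ → ℝ) : Prop :=
  ∃ c > (0 : ℝ), ∃ ε₀ > (0 : ℝ), ∃ γ > (0 : ℝ),
    ∃ᶠ d : ℕ in atTop, ∀ ε : ℝ, 0 < ε → ε ≤ ε₀ →
      ENNReal.ofReal (c * (1 + γ) ^ d) ≤ ((nSmooth D L d ε : ℕ∞) : ENNReal)

/-- The quasi-polynomial bound `ln n(ε, C_d^∞(L)) ≤ C (1 - ln ε) (1 + ln d)` with the constant `C`,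
for all `ε ∈ (0,1)` and `d ≥ 1`; it includes that `n(ε, C_d^∞(L))` is finite. -/
def QuasiPolynomialBound (D : (d : ℕ) → Set (E d)) (L : ℕ → ℕ → ℝ) (C : ℝ) : Prop :=
  ∀ d : ℕ, 1 ≤ d → ∀ ε : ℝ, 0 < ε → ε < 1 →
    ∃ N : ℕ, nSmooth D L d ε = (N : ℕ∞) ∧
      Real.log N ≤ C * (1 - Real.log ε) * (1 + Real.log d)

/-- `L = (L_{j,d})`, `j ≥ 0`, `d ≥ 1`, is a double sequence of positive numbers. -/
def PosBounds (L : ℕ → ℕ → ℝ) : Prop := ∀ j d : ℕ, 1 ≤ d → 0 < L j d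

end HighDimIntegration

end

noncomputable section

namespace HighDimIntegration

/-! Upper bounds. For all but finitely many `d`, a convex `D_d` lies in a ball of radius `√d / 2`
about one of its own points. The Taylor polynomial of degree `m` at that point approximates the
class up to `L_m (√d / 2)^(m+1) / m!`, and such polynomials lie in the span of `(d+1)^m` monomials.
Tchakaloff's theorem (`exists_exact_quadrature`) gives a positive quadrature formula exact on this
span with at most one node more than there are monomials; its error is at most twice the
approximation error. A fixed degree costs polynomially many values, which refutes the curse. Under
the factorial bounds the error is at most `c (1 - δ/2)^m`, so a degree of order `1 - ln ε` suffices.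
The finitely many remaining dimensions are cut into cells (`exists_uniform_hasCells`).

Lower bound. An adaptive algorithm that only sees zeros samples at fixed points. Take the squared
distance to a neighbourhood of their convex hull: it is convex, with second differences at most
those of `‖x‖²`. Average it over infinitely many kernels of radii `ρ_k √d` with `∑ ρ_k` bounded
(`exists_infinite_smear`). The result is smooth and still vanishes at the sample points, and
convexity keeps it above the original function. Each kernel is the square of a product of
one-dimensional profiles. The partial derivatives of that product are orthogonal in `L²`, so a
directional derivative of the kernel has `L¹` norm at most `(2C/ρ_k) ‖v‖` in every dimension
(`integral_abs_fderiv_kernel_le`). The second differences pay for the first two derivatives, and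
each average for one more, at the price of a factor `2C/ρ_k`. For `ρ_k` of order `k^(-(1+η/2))`
these products grow at most like `(j!)^(1+η)`.

The function is large away from the hull. The hull is covered by the balls with diameters `[p,
x_i]`, and a neighbourhood of each of them meets `D_d` in exponentially small volume
(`exists_volume_thalesSet_le`). Hence few sample points leave a large integral undetected
(`one_lt_card_mul_of_error_le`). -/

/-! ### Means in convex hulls and Tchakaloff's theorem -/

/-- The step that lowers the dimension: after a translation by the mean the problem lives in the
kernel of `l`, and the affine map back carries convex hulls to convex hulls. -/
theorem mem_convexHull_of_ae_eq_const {W : Type*} [NormedAddCommGroup W] [NormedSpace ℝ W]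
    [FiniteDimensional ℝ W] {Ω : Type*} [MeasurableSpace Ω] (μ : Measure Ω)
    (g : Ω → W) (hg : Integrable g μ) (S : Set W) (hS : ∀ᵐ t ∂μ, g t ∈ S)
    (hv : μ.real Set.univ = 1)
    (l : W →ₗ[ℝ] ℝ) (hl : ∀ᵐ t ∂μ, l (g t) = l (∫ t, g t ∂μ))
    (ih : ∀ (g' : Ω → LinearMap.ker l) (S' : Set (LinearMap.ker l)), Integrable g' μ →
      (∀ᵐ t ∂μ, g' t ∈ S') → ∫ t, g' t ∂μ ∈ convexHull ℝ S') :
    ∫ t, g t ∂μ ∈ convexHull ℝ S := by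
  have : IsFiniteMeasure μ := by
    refine ⟨lt_top_iff_ne_top.2 fun h => ?_⟩
    simp [Measure.real, h] at hv
  set v := ∫ t, g t ∂μ with hv'
  -- Any linear projection onto the kernel will do, since `g t - v` lies there for almost every `t`.
  obtain ⟨P, hP⟩ := (LinearMap.ker l).subtype.exists_leftInverse_of_injective
    (LinearMap.ker_eq_bot.2 (Submodule.subtype_injective _))
  have hP' : ∀ w : W, l w = 0 → ((P w : LinearMap.ker l) : W) = w := fun w hw => by
    have := congrArg (fun T => T ⟨w, hw⟩) hP
    simpa using congrArg Subtype.val this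
  let PL := LinearMap.toContinuousLinearMap P
  have hint : Integrable (fun t => g t - v) μ := hg.sub (integrable_const v)
  have h0 : ∫ t, PL (g t - v) ∂μ = 0 := by
    rw [PL.integral_comp_comm hint, integral_sub hg (integrable_const v), integral_const, hv]
    simp [hv']
  have := ih (fun t => PL (g t - v)) {k | v + (k : W) ∈ S} (PL.integrable_comp hint) (by
    filter_upwards [hS, hl] with t h1 h2
    have : ((PL (g t - v) : LinearMap.ker l) : W) = g t - v := hP' _ (by simp [h2])
    change v + ((PL (g t - v) : LinearMap.ker l) : W) ∈ S
    rw [this]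
    simpa using h1)
  rw [h0] at this
  let A : LinearMap.ker l →ᵃ[ℝ] W := (LinearMap.ker l).subtype.toAffineMap + AffineMap.const ℝ _ v
  have h1 : A 0 ∈ A '' convexHull ℝ {k : LinearMap.ker l | v + (k : W) ∈ S} := ⟨0, this, rfl⟩
  rw [A.image_convexHull] at h1
  have h2 : A 0 = v := by simp [A]
  rw [h2] at h1
  refine convexHull_mono ?_ h1
  rintro _ ⟨k, hk, rfl⟩
  simpa [A, add_comm] using hk

/-- In finite dimension the mean of a random vector lies in the convex hull (not only in its
closure) of any set that contains almost all of its values. -/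
theorem integral_mem_convexHull {W : Type*} [NormedAddCommGroup W] [NormedSpace ℝ W]
    [FiniteDimensional ℝ W] {Ω : Type*} [MeasurableSpace Ω] (μ : Measure Ω)
    [IsProbabilityMeasure μ] (g : Ω → W) (hg : Integrable g μ) (S : Set W)
    (hS : ∀ᵐ t ∂μ, g t ∈ S) : ∫ t, g t ∂μ ∈ convexHull ℝ S := by
  obtain ⟨n, hn⟩ : ∃ n, Module.finrank ℝ W = n := ⟨_, rfl⟩
  induction n using Nat.strong_induction_on generalizing W with
  | _ n ih =>
  have key : ∀ l : W →ₗ[ℝ] ℝ, l ≠ 0 → (∀ᵐ t ∂μ, l (g t) = l (∫ t, g t ∂μ)) →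
      ∫ t, g t ∂μ ∈ convexHull ℝ S := fun l hl0 hl => by
    refine mem_convexHull_of_ae_eq_const μ g hg S hS (by simp) l hl fun g' S' hg' hS' => ?_
    refine ih (Module.finrank ℝ (LinearMap.ker l)) ?_ g' hg' S' hS' rfl
    rw [← hn]
    exact Submodule.finrank_lt (fun h => hl0 (LinearMap.ker_eq_top.1 h))
  by_contra hv
  set C := convexHull ℝ S with hC
  have hCS : ∀ᵐ t ∂μ, g t ∈ C := hS.mono fun t h => subset_convexHull ℝ S h
  have hCc : Convex ℝ C := convex_convexHull ℝ S
  obtain ⟨t₀, ht₀⟩ := hS.exists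
  by_cases hint : (interior C).Nonempty
  -- A separating functional satisfies `l ≤ l v` on the hull, where `v` is the mean; since `l (g t)`
  -- has mean `l v`, equality holds almost everywhere.
  · obtain ⟨l, hl⟩ := geometric_hahn_banach_open_point hCc.interior isOpen_interior
      (fun h => hv (interior_subset h))
    have hle : ∀ c ∈ C, l c ≤ l (∫ t, g t ∂μ) := by
      intro c hc
      have : c ∈ closure (interior C) := by
        rw [hCc.closure_interior_eq_closure_of_nonempty_interior hint]; exact subset_closure hc
      exact closure_minimal (fun a ha => (hl a ha).le)
        (isClosed_le l.continuous continuous_const) this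
    refine hv (key l ?_ ?_)
    · rintro h0
      obtain ⟨a, ha⟩ := hint
      have := hl a ha
      have e : ∀ x, l x = 0 := fun x => by
        have := congrArg (fun T => T x) h0; simpa using this
      simp [e] at this
    · have h1 : ∫ t, (l (∫ t, g t ∂μ) - l (g t)) ∂μ = 0 := by
        rw [integral_sub (integrable_const _) (l.integrable_comp hg), l.integral_comp_comm hg]
        simp
      rw [integral_eq_zero_iff_of_nonneg_ae] at h1
      · filter_upwards [h1] with t h
        simp at h; simp; linarith
      · filter_upwards [hCS] with t h
        simpa using hle _ h
      · exact (integrable_const _).sub (l.integrable_comp hg)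
  -- A hull without interior lies in a proper affine subspace, on which some nonzero functional is
  -- constant.
  · rw [interior_convexHull_nonempty_iff_affineSpan_eq_top,
      AffineSubspace.affineSpan_eq_top_iff_vectorSpan_eq_top_of_nonempty ℝ W W ⟨_, ht₀⟩] at hint
    obtain ⟨l, hl0, hl⟩ := Submodule.exists_le_ker_of_lt_top _ (lt_top_iff_ne_top.2 hint)
    refine hv (key l hl0 ?_)
    have h1 : ∀ᵐ t ∂μ, l (g t) = l (g t₀) := by
      filter_upwards [hS] with t h
      have := hl (vsub_mem_vectorSpan ℝ h ht₀)
      simpa [sub_eq_zero] using this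
    let L := LinearMap.toContinuousLinearMap l
    have h2 : l (∫ t, g t ∂μ) = l (g t₀) := by
      have h3 : ∫ t, L (g t) ∂μ = l (g t₀) := by
        rw [integral_congr_ae (f := fun t => L (g t)) (g := fun _ => l (g t₀)) h1]
        simp
      rw [← h3, L.integral_comp_comm hg]
      rfl
    rw [h2]; exact h1

/-- Tchakaloff's theorem: for `N` integrable functions there is a positive quadrature formula with
at most `N + 1` nodes that integrates all their linear combinations exactly. -/
theorem exists_exact_quadrature {Ω : Type*} [MeasurableSpace Ω] (μ : Measure Ω)
    [IsProbabilityMeasure μ] {ι : Type*} [Fintype ι] (φ : ι → Ω → ℝ)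
    (hφ : ∀ i, Integrable (φ i) μ) (D : Set Ω) (hD : ∀ᵐ t ∂μ, t ∈ D) :
    ∃ (n : ℕ) (x : Fin n → Ω) (w : Fin n → ℝ), n ≤ Fintype.card ι + 1 ∧ (∀ i, x i ∈ D) ∧
      (∀ i, 0 ≤ w i) ∧ ∑ i, w i = 1 ∧ ∀ j, ∫ t, φ j t ∂μ = ∑ i, w i * φ j (x i) := by
  have hg : Integrable (fun t j => φ j t) μ := Integrable.of_eval hφ
  have h := integral_mem_convexHull μ (fun t j => φ j t) hg ((fun t j => φ j t) '' D)
    (hD.mono fun t h => ⟨t, h, rfl⟩)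
  -- Carathéodory: the points can be taken affinely independent, which bounds their number by the
  -- dimension plus one.
  obtain ⟨κ, _, z, w, hz, hai, hw, hw1, hsum⟩ := eq_pos_convex_span_of_mem_convexHull h
  have hcard := hai.card_le_finrank_succ
  have hcard' : Fintype.card κ ≤ Fintype.card ι + 1 := by
    refine hcard.trans (Nat.succ_le_succ ?_)
    calc _ ≤ Module.finrank ℝ (ι → ℝ) := Submodule.finrank_le _
      _ = _ := Module.finrank_fintype_fun_eq_card ℝ
  have hz' : ∀ k, ∃ x ∈ D, (fun j => φ j x) = z k := fun k => hz ⟨k, rfl⟩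
  choose x hxD hx using hz'
  let e := Fintype.equivFin κ
  refine ⟨Fintype.card κ, fun i => x (e.symm i), fun i => w (e.symm i), hcard',
    fun i => hxD _, fun i => (hw _).le, ?_, fun j => ?_⟩
  · rw [← hw1]; exact Equiv.sum_comp e.symm w
  · have h1 := congrFun hsum j
    rw [eval_integral hφ] at h1
    rw [← h1, Finset.sum_apply, ← Equiv.sum_comp e.symm]
    refine Finset.sum_congr rfl fun i _ => ?_
    rw [← hx]; rfl

/-! ### Quadrature formulas as algorithms -/

namespace Algorithm

variable {d : ℕ} {D : Set (E d)}

theorem length_values (A : Algorithm D) (f : E d → ℝ) (n : ℕ) : (A.values f n).length = n := by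
  induction n with
  | zero => rfl
  | succ n ih => simp [values, ih]

/-- The nonadaptive algorithm given by a quadrature formula. -/
def ofQuadrature {x₀ : E d} (hx₀ : x₀ ∈ D) {n : ℕ} (x : Fin n → E d) (hx : ∀ i, x i ∈ D)
    (w : Fin n → ℝ) : Algorithm D where
  node v := if h : v.length < n then x ⟨v.length, h⟩ else x₀
  node_mem v := by split_ifs; exacts [hx _, hx₀]
  output v := ∑ i : Fin n, w i * v.getD i 0

theorem values_ofQuadrature {x₀ : E d} (hx₀ : x₀ ∈ D) {n : ℕ} (x : Fin n → E d)
    (hx : ∀ i, x i ∈ D) (w : Fin n → ℝ) (f : E d → ℝ) (k : ℕ) (hk : k ≤ n) (i : ℕ) (hi : i < k) :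
    ((ofQuadrature hx₀ x hx w).values f k).getD i 0 = f (x ⟨i, hi.trans_le hk⟩) := by
  induction k with
  | zero => omega
  | succ k ih =>
    rw [values]
    have hl := length_values (ofQuadrature hx₀ x hx w) f k
    rcases Nat.lt_succ_iff_lt_or_eq.1 hi with h | h
    · rw [List.getD_append _ _ _ _ (by omega)]
      exact ih (by omega) h
    · subst h
      rw [List.getD_append_right _ _ _ _ (by omega)]
      simp only [hl, Nat.sub_self, List.getD_cons_zero]
      congr 1
      simp only [ofQuadrature]
      rw [dif_pos (by rw [ofQuadrature] at hl; rw [hl]; omega)]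
      congr 1
      ext
      exact hl

theorem apply_ofQuadrature {x₀ : E d} (hx₀ : x₀ ∈ D) {n : ℕ} (x : Fin n → E d)
    (hx : ∀ i, x i ∈ D) (w : Fin n → ℝ) (f : E d → ℝ) :
    (ofQuadrature hx₀ x hx w).apply n f = ∑ i, w i * f (x i) := by
  rw [Algorithm.apply]
  change ∑ i : Fin n, w i * _ = _
  refine Finset.sum_congr rfl fun i _ => ?_
  rw [values_ofQuadrature hx₀ x hx w f n le_rfl i i.2]

end Algorithm

/-- If the functions of the class `F` are approximated up to `β` on `D` by linear combinations of
`N` fixed functions, then `N + 1` function values suffice for the error `2 β`. -/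
theorem infoComplexity_le_card {d : ℕ} {D : Set (E d)} (hDm : MeasurableSet D)
    (hD : volume D = 1) {ι : Type*} [Fintype ι] (φ : ι → E d → ℝ)
    (hφ : ∀ i, IntegrableOn (φ i) D) (F : Set (E d → ℝ)) {β ε : ℝ} (hβ : 2 * β ≤ ε)
    (hF : ∀ f ∈ F, IntegrableOn f D ∧ ∃ a : ι → ℝ, ∀ x ∈ D, |f x - ∑ i, a i * φ i x| ≤ β) :
    infoComplexity D F ε ≤ ((Fintype.card ι + 1 : ℕ) : ℕ∞) := by
  have : IsProbabilityMeasure (volume.restrict D) := ⟨by simpa using hD⟩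
  obtain ⟨n, x, w, hn, hx, hw, hw1, hex⟩ := exists_exact_quadrature (volume.restrict D) φ hφ D
    (ae_restrict_mem hDm)
  obtain ⟨x₀, hx₀⟩ : D.Nonempty := nonempty_of_measure_ne_zero (by rw [hD]; simp)
  refine le_trans ?_ (Nat.cast_le.2 hn)
  refine iInf₂_le n ⟨Algorithm.ofQuadrature hx₀ x hx w, ?_⟩
  refine iSup₂_le fun f hf => ENNReal.ofReal_le_ofReal ?_
  obtain ⟨hfi, a, ha⟩ := hF f hf
  rw [Algorithm.apply_ofQuadrature]
  have hsum : IntegrableOn (fun x => ∑ i, a i * φ i x) D :=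
    integrable_finsetSum _ fun i _ => (hφ i).const_mul _
  have h1 : |∫ x in D, (f x - ∑ i, a i * φ i x)| ≤ β := by
    have := norm_setIntegral_le_of_norm_le_const (μ := volume) (s := D) (C := β)
      (f := fun x => f x - ∑ i, a i * φ i x) (by rw [hD]; simp) (fun x hx => ha x hx)
    simpa [Measure.real, hD] using this
  have h2 : |∑ k, w k * (f (x k) - ∑ i, a i * φ i (x k))| ≤ β := by
    calc _ ≤ ∑ k, w k * β := (Finset.abs_sum_le_sum_abs _ _).trans <|
          Finset.sum_le_sum fun k _ => by
            rw [abs_mul, abs_of_nonneg (hw k)]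
            exact mul_le_mul_of_nonneg_left (ha _ (hx k)) (hw k)
      _ = β := by rw [← Finset.sum_mul, hw1, one_mul]
  have h3 : ∫ x in D, ∑ i, a i * φ i x = ∑ k, w k * ∑ i, a i * φ i (x k) := by
    rw [integral_finsetSum _ fun i _ => (hφ i).const_mul _]
    simp_rw [integral_const_mul, hex, Finset.mul_sum]
    rw [Finset.sum_comm]
    exact Finset.sum_congr rfl fun _ _ => Finset.sum_congr rfl fun _ _ => by ring
  rw [integral_sub hfi hsum, h3] at h1
  simp_rw [mul_sub] at h2
  rw [Finset.sum_sub_distrib] at h2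
  rw [abs_le] at *
  constructor <;> linarith [h1.1, h1.2, h2.1, h2.2]

/-! ### Taylor polynomials and the monomials that span them -/

/-- Derivatives within `[0, 1]` are used because only this part of the line is known to lie in `D`.
-/
theorem iteratedDerivWithin_comp_line {V : Type*} [NormedAddCommGroup V] [NormedSpace ℝ V]
    {D : Set V} (hDo : IsOpen D) {f : V → ℝ} (hf : ContDiffOn ℝ ∞ f D) {z v : V}
    (hseg : ∀ t ∈ Set.Icc (0 : ℝ) 1, z + t • v ∈ D) (k : ℕ) :
    ∀ t ∈ Set.Icc (0 : ℝ) 1, iteratedDerivWithin k (fun t : ℝ => f (z + t • v)) (Set.Icc 0 1) t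
      = iteratedFDeriv ℝ k f (z + t • v) (fun _ => v) := by
  induction k with
  | zero => intro t ht; simp
  | succ k ih =>
    intro t ht
    rw [iteratedDerivWithin_succ, derivWithin_congr ih (ih t ht)]
    have h1 : DifferentiableAt ℝ (iteratedFDeriv ℝ k f) (z + t • v) :=
      (hf.contDiffAt (hDo.mem_nhds (hseg t ht))).differentiableAt_iteratedFDeriv
        (by exact_mod_cast ENat.natCast_lt_top k)
    have h2 : HasDerivAt (fun t : ℝ => z + t • v) v t := by
      simpa using ((hasDerivAt_id t).smul_const v).const_add z
    have h3 := (h1.hasFDerivAt.comp_hasDerivAt t h2)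
    have h4 := ((ContinuousMultilinearMap.apply ℝ (fun _ : Fin k => V) ℝ
      (fun _ => v)).hasFDerivAt.comp_hasDerivAt t h3)
    have h5 := (h4.hasDerivWithinAt (s := Set.Icc 0 1)).derivWithin
      (uniqueDiffOn_Icc zero_lt_one t ht)
    rw [iteratedFDeriv_succ_apply_left]
    exact h5

/-- Taylor's formula with the remainder expressed through the Lipschitz constant of the highest
derivative that is used. -/
theorem abs_sub_taylor_le {V : Type*} [NormedAddCommGroup V] [NormedSpace ℝ V]
    {D : Set V} (hDo : IsOpen D) (hDc : Convex ℝ D) {f : V → ℝ} (hf : ContDiffOn ℝ ∞ f D)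
    {m : ℕ} {L : ℝ} (hL : 0 ≤ L) (hLip : ∀ x ∈ D, ∀ y ∈ D,
      ‖iteratedFDeriv ℝ m f x - iteratedFDeriv ℝ m f y‖ ≤ L * ‖x - y‖)
    {z x : V} (hz : z ∈ D) (hx : x ∈ D) :
    |f x - ∑ k ∈ Finset.range (m + 1), (k.factorial : ℝ)⁻¹ *
      iteratedFDeriv ℝ k f z (fun _ => x - z)| ≤ L * ‖x - z‖ ^ (m + 1) / m.factorial := by
  set v := x - z with hv
  have hseg : ∀ t ∈ Set.Icc (0 : ℝ) 1, z + t • v ∈ D := fun t ht => by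
    have := hDc.add_smul_sub_mem hz hx ht
    simpa [hv] using this
  have key : ∀ t ∈ Set.Icc (0 : ℝ) 1, |iteratedFDeriv ℝ m f (z + t • v) (fun _ => v) -
      iteratedFDeriv ℝ m f z (fun _ => v)| ≤ L * ‖v‖ ^ (m + 1) := fun t ht => by
    have h1 := (iteratedFDeriv ℝ m f (z + t • v) - iteratedFDeriv ℝ m f z).le_opNorm (fun _ => v)
    have h2 := hLip _ (hseg t ht) z hz
    simp only [add_sub_cancel_left, norm_smul, Real.norm_eq_abs, abs_of_nonneg ht.1] at h2
    have h3 : L * (t * ‖v‖) ≤ L * ‖v‖ :=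
      mul_le_mul_of_nonneg_left (mul_le_of_le_one_left (norm_nonneg _) ht.2) hL
    simp only [Finset.prod_const, Finset.card_univ, Fintype.card_fin] at h1
    rw [← Real.norm_eq_abs, ← sub_apply]
    refine h1.trans ?_
    rw [pow_succ', ← mul_assoc]
    exact mul_le_mul_of_nonneg_right (h2.trans h3) (by positivity)
  have hfx : f x = f (z + (1 : ℝ) • v) := by simp [hv]
  -- The Lagrange remainder expresses the error through the derivative of order `n + 1 = m`, so `m =
  -- 0` is separate and is the Lipschitz bound itself.
  rcases m with _ | n
  · have := key 1 (by simp)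
    simpa [hfx] using this
  have hcd : ContDiffOn ℝ ∞ (fun t : ℝ => f (z + t • v)) (Set.Icc 0 1) :=
    hf.comp (by fun_prop) hseg
  have hu : Set.uIcc (0 : ℝ) 1 = Set.Icc 0 1 := Set.uIcc_of_le zero_le_one
  obtain ⟨ξ, hξ, he⟩ := taylor_mean_remainder_lagrange (f := fun t : ℝ => f (z + t • v))
    (x := 1) (x₀ := 0) (n := n) zero_ne_one (by rw [hu]; exact hcd.of_le (by exact_mod_cast le_top))
    (by
      rw [hu]
      exact (hcd.differentiableOn_iteratedDerivWithin (by exact_mod_cast ENat.natCast_lt_top n)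
        (uniqueDiffOn_Icc zero_lt_one)).mono (by
          rw [Set.uIoo_of_le zero_le_one]; exact Set.Ioo_subset_Icc_self))
  rw [Set.uIoo_of_le zero_le_one] at hξ
  have hξ' := Set.Ioo_subset_Icc_self hξ
  rw [hu, taylor_within_apply, iteratedDerivWithin_comp_line hDo hf hseg _ ξ hξ'] at he
  have h0 : ∀ k, iteratedDerivWithin k (fun t : ℝ => f (z + t • v)) (Set.Icc 0 1) 0 =
      iteratedFDeriv ℝ k f z (fun _ => v) := fun k => by
    rw [iteratedDerivWithin_comp_line hDo hf hseg k 0 (by simp)]; simp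
  simp only [h0, sub_zero, one_pow, mul_one, smul_eq_mul, ← hfx] at he
  -- Subtracting the top Taylor term from the Lagrange remainder leaves the difference of the `m`-th
  -- derivatives at two points of the segment.
  rw [Finset.sum_range_succ, ← sub_sub, he, div_eq_inv_mul, ← mul_sub, abs_mul,
    abs_of_nonneg (by positivity), div_eq_inv_mul]
  exact mul_le_mul_of_nonneg_left (key ξ hξ') (by positivity)

/-- The product of `m` of the functions `1, y₁, …, y_d`. -/
def monomialFun {d m : ℕ} (s : Fin m → Option (Fin d)) (y : E d) : ℝ :=
  ∏ j, (s j).elim 1 (fun i => y i)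

theorem continuous_monomialFun {d m : ℕ} (s : Fin m → Option (Fin d)) :
    Continuous (monomialFun s) := by
  refine continuous_finsetProd _ fun j _ => ?_
  cases s j with
  | none => exact continuous_const
  | some i => simp only [Option.elim]; fun_prop

/-- Expansion in the standard basis. Products of `k ≤ m` coordinates are padded by constant factors
`1` to length `m`, so that one index type of size `(d+1)^m` serves all degrees. -/
theorem multilinear_mem_span_monomialFun {d k m : ℕ} (hk : k ≤ m)
    (A : ContinuousMultilinearMap ℝ (fun _ : Fin k => E d) ℝ) :
    (fun y => A fun _ => y) ∈
      Submodule.span ℝ (Set.range (monomialFun : (Fin m → Option (Fin d)) → E d → ℝ)) := by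
  obtain ⟨l, rfl⟩ := Nat.exists_eq_add_of_le hk
  have hA : (fun y => A fun _ => y) = ∑ r : Fin k → Fin d,
      A (fun j => EuclideanSpace.single (r j) (1 : ℝ)) •
        (monomialFun (Fin.append (fun j => some (r j)) (fun _ : Fin l => none))) := by
    ext y
    have hy : y = ∑ i, y i • EuclideanSpace.single i (1 : ℝ) := by
      ext i
      simp [Finset.sum_apply, Pi.single_apply]
    conv_lhs => rw [hy]
    have := A.toMultilinearMap.map_sum
      (fun (_ : Fin k) (i : Fin d) => y i • EuclideanSpace.single i (1 : ℝ))
    simp only [ContinuousMultilinearMap.coe_coe] at this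
    rw [this, Finset.sum_apply]
    refine Finset.sum_congr rfl fun r _ => ?_
    have h2 := A.map_smul_univ (fun j => y (r j)) (fun j => EuclideanSpace.single (r j) (1 : ℝ))
    rw [h2]
    simp [monomialFun, Fin.prod_univ_add, mul_comm]
  rw [hA]
  exact Submodule.sum_mem _ fun r _ => Submodule.smul_mem _ _ (Submodule.subset_span ⟨_, rfl⟩)

theorem taylor_mem_span_monomialFun {d m : ℕ} (f : E d → ℝ) (z : E d) :
    ∃ a : (Fin m → Option (Fin d)) → ℝ, ∀ y, ∑ k ∈ Finset.range (m + 1), (k.factorial : ℝ)⁻¹ *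
      iteratedFDeriv ℝ k f z (fun _ => y) = ∑ s, a s * monomialFun s y := by
  have h : (∑ k ∈ Finset.range (m + 1), (k.factorial : ℝ)⁻¹ •
      fun y => iteratedFDeriv ℝ k f z (fun _ => y)) ∈
      Submodule.span ℝ (Set.range (monomialFun : (Fin m → Option (Fin d)) → E d → ℝ)) :=
    Submodule.sum_mem _ fun k hk => Submodule.smul_mem _ _
      (multilinear_mem_span_monomialFun (Nat.lt_succ_iff.1 (Finset.mem_range.1 hk)) _)
  obtain ⟨a, ha⟩ := (Submodule.mem_span_range_iff_exists_fun ℝ).1 h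
  refine ⟨a, fun y => ?_⟩
  have := congrFun ha y
  simpa [Finset.sum_apply] using this.symm

/-! ### Piecewise Taylor approximation on cells -/

/-- `D` can be split into at most `K` measurable parts, each of which lies in a ball of radius `R`
around a point of `D`. -/
def HasCells {d : ℕ} (D : Set (E d)) (K : ℕ) (R : ℝ) : Prop :=
  ∃ (cell : E d → Fin K) (z : Fin K → E d), Measurable cell ∧ (∀ c, z c ∈ D) ∧
    ∀ x ∈ D, ‖x - z (cell x)‖ ≤ R

theorem abs_monomialFun_le {d m : ℕ} (s : Fin m → Option (Fin d)) {y : E d} {R : ℝ}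
    (hy : ‖y‖ ≤ R) : |monomialFun s y| ≤ (max 1 R) ^ m := by
  rw [monomialFun, Finset.abs_prod]
  calc _ ≤ ∏ _j : Fin m, max 1 R := Finset.prod_le_prod (fun _ _ => abs_nonneg _) fun j _ => by
        cases s j with
        | none => simp
        | some i => exact ((PiLp.norm_apply_le y i).trans hy).trans (le_max_right _ _)
    _ = _ := by simp

theorem integrableOn_of_mem_smoothClass {d : ℕ} {D : Set (E d)} (hDo : IsOpen D)
    (hD : volume D = 1) {L : ℕ → ℝ} {f : E d → ℝ} (hf : f ∈ smoothClass D L) :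
    IntegrableOn f D := by
  refine IntegrableOn.of_bound (by rw [hD]; simp)
    (hf.1.continuousOn.aestronglyMeasurable hDo.measurableSet) 1 ?_
  filter_upwards [ae_restrict_mem hDo.measurableSet] with x hx using hf.2.1 x hx

/-- Taylor polynomials in each cell give an upper bound for the information complexity. -/
theorem infoComplexity_smoothClass_le {d : ℕ} {D : Set (E d)} (hDo : IsOpen D)
    (hDc : Convex ℝ D) (hD : volume D = 1) {K : ℕ} {R : ℝ} (hK : HasCells D K R) {L : ℕ → ℝ}
    {m : ℕ} (hL : 0 ≤ L m) {ε : ℝ} (hε : 2 * (L m * R ^ (m + 1) / m.factorial) ≤ ε) :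
    infoComplexity D (smoothClass D L) ε ≤ ((K * (d + 1) ^ m + 1 : ℕ) : ℕ∞) := by
  obtain ⟨cell, z, hcell, hz, hR⟩ := hK
  -- The monomials centred at each `z c`, cut off outside the cell `c`: at a point only its own cell
  -- contributes.
  let φ : Fin K × (Fin m → Option (Fin d)) → E d → ℝ := fun p x =>
    if cell x = p.1 then monomialFun p.2 (x - z p.1) else 0
  have hφ : ∀ p, IntegrableOn (φ p) D := fun p => by
    have hmeas : Measurable (φ p) := Measurable.ite (hcell (measurableSet_singleton _))
      ((continuous_monomialFun p.2).comp (by fun_prop : Continuous fun x => x - z p.1)).measurable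
      measurable_const
    refine IntegrableOn.of_bound (by rw [hD]; simp) hmeas.aestronglyMeasurable ((max 1 R) ^ m) ?_
    filter_upwards [ae_restrict_mem hDo.measurableSet] with x hx
    simp only [φ]
    split_ifs with h
    · exact abs_monomialFun_le _ (h ▸ hR x hx)
    · simp only [norm_zero]; positivity
  have hcard : Fintype.card (Fin K × (Fin m → Option (Fin d))) = K * (d + 1) ^ m := by simp
  rw [← hcard]
  refine infoComplexity_le_card hDo.measurableSet hD φ hφ _ hε fun f hf =>
    ⟨integrableOn_of_mem_smoothClass hDo hD hf, ?_⟩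
  choose a ha using fun c => taylor_mem_span_monomialFun (m := m) f (z c)
  refine ⟨fun p => a p.1 p.2, fun x hx => ?_⟩
  have hsum : ∑ p, a p.1 p.2 * φ p x =
      ∑ s, a (cell x) s * monomialFun s (x - z (cell x)) := by
    rw [Fintype.sum_prod_type, Finset.sum_eq_single (cell x)]
    · simp [φ]
    · intro c _ hc
      simp [φ, hc.symm]
    · simp
  rw [hsum, ← ha]
  refine (abs_sub_taylor_le hDo hDc hf.1 hL (hf.2.2 m) (hz _) hx).trans ?_
  have := hR x hx
  gcongr

theorem hasCells_one {d : ℕ} {D : Set (E d)} {R : ℝ} {z : E d} (hz : z ∈ D)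
    (hR : ∀ x ∈ D, ‖x - z‖ ≤ R) : HasCells D 1 R :=
  ⟨fun _ => 0, fun _ => z, measurable_const, fun _ => hz, hR⟩

/-- A bounded nonempty set can be split into finitely many cells of a given radius. -/
theorem exists_hasCells {d : ℕ} {D : Set (E d)} (hne : D.Nonempty) (hb : Bornology.IsBounded D)
    {R : ℝ} (hR : 0 < R) : ∃ K, HasCells D K R := by
  classical
  obtain ⟨x₀, hx₀⟩ := hne
  have htb := (hb.isCompact_closure.totallyBounded).subset subset_closure
  obtain ⟨t, htD, htf, ht⟩ := Metric.finite_approx_of_totallyBounded htb R hR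
  let l := htf.toFinset.toList
  let z : ℕ → E d := fun k => l.getD k x₀
  have hz : ∀ k, z k ∈ D := fun k => by
    rcases lt_or_ge k l.length with h | h
    · have : z k = l[k] := List.getD_eq_getElem _ _ h
      rw [this]
      refine htD ?_
      exact htf.mem_toFinset.1 (Finset.mem_toList.1 (List.getElem_mem h))
    · have : z k = x₀ := List.getD_eq_default _ _ h
      rwa [this]
  -- A point goes to the first centre within distance `R`. The second alternative makes the search
  -- total off `D`, with one spare cell centred at `x₀`.
  have hex : ∀ x : E d, ∃ k, ‖x - z k‖ ≤ R ∨ l.length ≤ k := fun x => ⟨l.length, Or.inr le_rfl⟩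
  have hmeas : Measurable fun x => Nat.find (hex x) := measurable_find hex fun k =>
    ((isClosed_le (f := fun x : E d => ‖x - z k‖) (by fun_prop)
      continuous_const).measurableSet).union (MeasurableSet.const (l.length ≤ k))
  refine ⟨l.length + 1, fun x => Fin.ofNat _ (Nat.find (hex x)), fun k => z k,
    (measurable_from_top (f := fun k : ℕ => Fin.ofNat (l.length + 1) k)).comp hmeas,
    fun _ => hz _, fun x hx => ?_⟩
  obtain ⟨y, hy, hxy⟩ := Set.mem_iUnion₂.1 (ht hx)
  obtain ⟨k, hk, hkz⟩ : ∃ k < l.length, z k = y := by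
    obtain ⟨k, hk, rfl⟩ := List.getElem_of_mem (a := y) (l := l) (by simpa [l] using hy)
    exact ⟨k, hk, List.getD_eq_getElem _ _ hk⟩
  have hlt : Nat.find (hex x) < l.length := lt_of_le_of_lt (Nat.find_min' (hex x) (Or.inl (by
    rw [hkz, ← dist_eq_norm]; exact (Metric.mem_ball.1 hxy).le))) hk
  have h1 := (Nat.find_spec (hex x)).resolve_right (not_le.2 hlt)
  have h2 : ((Fin.ofNat (l.length + 1) (Nat.find (hex x)) : Fin _) : ℕ) = Nat.find (hex x) :=
    Nat.mod_eq_of_lt (by omega)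
  simpa only [h2] using h1

/-- A convex open set of finite volume is bounded. -/
theorem isBounded_of_convex_of_volume {d : ℕ} {D : Set (E d)} (hDo : IsOpen D)
    (hDc : Convex ℝ D) (hne : D.Nonempty) (hD : volume D ≠ ⊤) : Bornology.IsBounded D := by
  obtain ⟨a, ha⟩ := hne
  obtain ⟨r, hr, hball⟩ := Metric.isOpen_iff.1 hDo a ha
  set v := volume (Metric.ball (0 : E d) (r / 2)) with hv
  have hv0 : v ≠ 0 := (Metric.measure_ball_pos volume _ (by positivity)).ne'
  -- the number of disjoint balls that fit in a segment of a given length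
  have key : ∀ y ∈ D, ∀ n : ℕ, 2 * n * r ≤ ‖y - a‖ → (n : ENNReal) * v ≤ volume D := by
    intro y hy n hn
    rcases Nat.eq_zero_or_pos n with rfl | hn0
    · simp
    have hnr : (0 : ℝ) < n := by exact_mod_cast hn0
    have hya : 0 < ‖y - a‖ := lt_of_lt_of_le (by positivity) hn
    -- The centres stay in the half of the segment next to `a`: the contraction towards `y` that
    -- moves `a` to such a centre shrinks the ball of radius `r` in `D` by a factor at least `1/2`.
    let c : Fin n → E d := fun k => a + ((k : ℝ) / (2 * n)) • (y - a)
    have hdis : Pairwise (Function.onFun Disjoint fun k => Metric.ball (c k) (r / 2)) := by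
      intro k l hkl
      refine Metric.ball_disjoint_ball ?_
      have h1 : dist (c k) (c l) = |(k : ℝ) - l| / (2 * n) * ‖y - a‖ := by
        rw [dist_eq_norm]
        have : c k - c l = (((k : ℝ) - l) / (2 * n)) • (y - a) := by
          simp only [c]; rw [sub_div, sub_smul]; abel
        rw [this, norm_smul, Real.norm_eq_abs, abs_div, abs_of_pos (by positivity : (0:ℝ) < 2 * n)]
      have h2 : (1 : ℝ) ≤ |(k : ℝ) - l| := by
        have : (k : ℤ) - l ≠ 0 := fun h => hkl (Fin.ext (by omega))
        exact_mod_cast Int.one_le_abs this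
      rw [h1]
      calc r / 2 + r / 2 = 1 / (2 * n) * (2 * n * r) := by field_simp; ring
        _ ≤ |(k : ℝ) - l| / (2 * n) * ‖y - a‖ := by gcongr
    have hsub : (⋃ k, Metric.ball (c k) (r / 2)) ⊆ D := by
      refine Set.iUnion_subset fun k x hx => ?_
      set t : ℝ := (k : ℝ) / (2 * n) with ht
      have ht0 : 0 ≤ t := by positivity
      have ht1 : t ≤ 1 / 2 := by
        rw [ht, div_le_iff₀ (by positivity)]
        have : (k : ℝ) ≤ n := by exact_mod_cast k.2.le
        linarith
      have h1t : 0 < 1 - t := by linarith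
      set u : E d := a + (1 - t)⁻¹ • (x - c k) with hu
      have huD : u ∈ D := by
        refine hball ?_
        rw [Metric.mem_ball, dist_eq_norm] at hx ⊢
        have : u - a = (1 - t)⁻¹ • (x - c k) := by simp [hu]
        rw [this, norm_smul, Real.norm_eq_abs, abs_of_pos (by positivity), inv_mul_lt_iff₀ h1t]
        nlinarith
      have hx' : x = (1 - t) • u + t • y := by
        rw [hu, smul_add, smul_inv_smul₀ h1t.ne']
        simp only [c, ← ht]
        module
      rw [hx']
      exact hDc huD hy h1t.le ht0 (by ring)
    calc (n : ENNReal) * v = ∑ k : Fin n, volume (Metric.ball (c k) (r / 2)) := by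
          simp [Measure.addHaar_ball_center, hv]
      _ = volume (⋃ k, Metric.ball (c k) (r / 2)) := by
          rw [measure_iUnion hdis fun _ => Metric.isOpen_ball.measurableSet, tsum_fintype]
      _ ≤ volume D := measure_mono hsub
  obtain ⟨n, hn⟩ : ∃ n : ℕ, volume D < n * v := by
    obtain ⟨n, hn⟩ := ENNReal.exists_nat_gt (ENNReal.div_ne_top hD hv0)
    refine ⟨n, ?_⟩
    rwa [ENNReal.div_lt_iff (Or.inl hv0) (Or.inr hD)] at hn
  refine (Metric.isBounded_closedBall (x := a) (r := 2 * n * r)).subset fun y hy => ?_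
  rw [Metric.mem_closedBall, dist_eq_norm]
  by_contra h
  exact absurd (key y hy n (not_le.1 h).le) (not_le.2 hn)

/-! ### Centres and radii of the domains -/

theorem unitCube_eq_preimage (d : ℕ) :
    unitCube d = WithLp.ofLp ⁻¹' (Set.univ.pi fun _ : Fin d => Set.Ioo (0 : ℝ) 1) := by
  ext x; simp [unitCube]

theorem isOpen_unitCube (d : ℕ) : IsOpen (unitCube d) := by
  rw [unitCube_eq_preimage]
  exact (isOpen_set_pi Set.finite_univ fun _ _ => isOpen_Ioo).preimage (PiLp.continuous_ofLp _ _)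

theorem volume_unitCube (d : ℕ) : volume (unitCube d) = 1 := by
  rw [unitCube_eq_preimage, (PiLp.volume_preserving_ofLp (Fin d)).measure_preimage
    (MeasurableSet.univ_pi fun _ => measurableSet_Ioo).nullMeasurableSet, volume_pi_pi]
  simp

/-- The centre of the unit cube. -/
def cubeCenter (d : ℕ) : E d := WithLp.toLp 2 fun _ => 1 / 2

theorem cubeCenter_mem (d : ℕ) : cubeCenter d ∈ unitCube d := fun i => by
  constructor <;> simp [cubeCenter]; norm_num

theorem norm_sub_cubeCenter_le {d : ℕ} {x : E d} (hx : x ∈ unitCube d) :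
    ‖x - cubeCenter d‖ ≤ 1 / 2 * √d := by
  rw [EuclideanSpace.norm_eq, show (1 / 2 : ℝ) * √d = √(d * (1 / 2) ^ 2) by
    rw [Real.sqrt_mul (by positivity), Real.sqrt_sq (by norm_num), mul_comm]]
  refine Real.sqrt_le_sqrt ?_
  calc _ ≤ ∑ _i : Fin d, (1 / 2 : ℝ) ^ 2 := Finset.sum_le_sum fun i _ => by
        have := hx i
        rw [Real.norm_eq_abs, sq_abs]
        simp only [cubeCenter, PiLp.sub_apply]
        nlinarith [this.1, this.2]
    _ = _ := by simp

/-- Lets the radius `√d / 2` of the cube serve for sets of small radius as well. -/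
theorem sqrt_two_div_pi_mul_exp_lt : √(2 / (Real.pi * Real.exp 1)) < 1 / 2 := by
  rw [Real.sqrt_lt' (by norm_num), div_lt_iff₀ (by positivity)]
  nlinarith [Real.pi_gt_three, Real.exp_one_gt_d9]

/-- The strict inequality for the limsup leaves room for a number `ρ` in between, so the infimum
over centres can be replaced by an actual centre. -/
theorem IsSmallRadius.exists_center {D : (d : ℕ) → Set (E d)} (hD : IsSmallRadius D) :
    ∃ ρ : ℝ, 0 ≤ ρ ∧ ρ < √(2 / (Real.pi * Real.exp 1)) ∧
      ∀ᶠ d in atTop, ∃ p : E d, ∀ x ∈ D d, ‖x - p‖ ≤ ρ * √d := by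
  obtain ⟨q, hq1, hq2⟩ := exists_between hD.2
  have hqt : q ≠ ⊤ := (hq2.trans ENNReal.ofReal_lt_top).ne
  refine ⟨q.toReal, ENNReal.toReal_nonneg, ?_, ?_⟩
  · have h0 : 0 < √(2 / (Real.pi * Real.exp 1)) := by positivity
    rwa [← ENNReal.lt_ofReal_iff_toReal_lt hqt]
  · filter_upwards [eventually_lt_of_limsup_lt hq1, eventually_gt_atTop 0] with d hd hd0
    have hs : 0 < √(d : ℝ) := by positivity
    rw [ENNReal.div_lt_iff (Or.inl (by simpa using hs)) (Or.inl ENNReal.ofReal_ne_top),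
      radius, iInf_lt_iff] at hd
    obtain ⟨p, hp⟩ := hd
    refine ⟨p, fun x hx => ?_⟩
    have h1 : edist x p ≤ q * ENNReal.ofReal √d :=
      (le_iSup₂ (f := fun y (_ : y ∈ D d) => edist y p) x hx).trans hp.le
    rw [← dist_eq_norm, dist_edist]
    refine (ENNReal.toReal_mono (by finiteness) h1).trans ?_
    rw [ENNReal.toReal_mul, ENNReal.toReal_ofReal hs.le]

theorem isOpen_and_volume_eq_one {D : (d : ℕ) → Set (E d)} (hD : IsCubes D ∨ IsSmallRadius D)
    {d : ℕ} (hd : 1 ≤ d) : IsOpen (D d) ∧ volume (D d) = 1 := by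
  rcases hD with h | h
  · rw [h d hd]; exact ⟨isOpen_unitCube d, volume_unitCube d⟩
  · exact h.1 d hd

/-- The centre of a ball that contains a convex set can be moved into the set. -/
theorem exists_center_mem {d : ℕ} {D : Set (E d)} (hDc : Convex ℝ D) (hne : D.Nonempty) {p : E d}
    {r R : ℝ} (hr : ∀ x ∈ D, ‖x - p‖ ≤ r) (hrR : r < R) : ∃ z ∈ D, ∀ x ∈ D, ‖x - z‖ ≤ R := by
  -- Replacing `p` by its nearest point `q` in the closure brings it no farther from any point of
  -- `D`; moving from `q` into `D` itself costs less than `R - r`.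
  obtain ⟨q, hq, hqp⟩ := exists_norm_eq_iInf_of_complete_convex hne.closure
    isClosed_closure.isComplete hDc.closure p
  rw [norm_eq_iInf_iff_real_inner_le_zero hDc.closure hq] at hqp
  have h1 : ∀ x ∈ D, ‖x - q‖ ≤ r := fun x hx => by
    have h2 := hqp x (subset_closure hx)
    have h3 : ‖x - p‖ ^ 2 = ‖x - q‖ ^ 2 - 2 * inner ℝ (p - q) (x - q) + ‖p - q‖ ^ 2 := by
      rw [show x - p = (x - q) - (p - q) by abel, norm_sub_sq_real, real_inner_comm]
    refine le_trans (le_of_sq_le_sq ?_ (norm_nonneg _)) (hr x hx)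
    nlinarith [sq_nonneg ‖p - q‖]
  obtain ⟨z, hz, hqz⟩ := Metric.mem_closure_iff.1 hq (R - r) (by linarith)
  refine ⟨z, hz, fun x hx => ?_⟩
  rw [dist_eq_norm] at hqz
  calc ‖x - z‖ = ‖(x - q) + (q - z)‖ := by congr 1; abel
    _ ≤ _ := (norm_add_le _ _).trans (by linarith [h1 x hx])

theorem eventually_hasCells {D : (d : ℕ) → Set (E d)} (hD : IsCubes D ∨ IsSmallRadius D)
    (hDc : ∀ d : ℕ, 1 ≤ d → Convex ℝ (D d)) :
    ∀ᶠ d in atTop, HasCells (D d) 1 (1 / 2 * √d) := by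
  rcases hD with h | h
  · filter_upwards [eventually_ge_atTop 1] with d hd
    rw [h d hd]
    exact hasCells_one (cubeCenter_mem d) fun x hx => norm_sub_cubeCenter_le hx
  · obtain ⟨ρ, hρ0, hρ, hev⟩ := h.exists_center
    filter_upwards [eventually_ge_atTop 1, hev] with d hd ⟨p, hp⟩
    have hs : 0 < √(d : ℝ) := by positivity
    have hne : (D d).Nonempty := nonempty_of_measure_ne_zero (by rw [(h.1 d hd).2]; simp)
    obtain ⟨z, hz, hzR⟩ := exists_center_mem (hDc d hd) hne hp (R := 1 / 2 * √d) (by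
      have := hρ.trans sqrt_two_div_pi_mul_exp_lt
      nlinarith)
    exact hasCells_one hz hzR

/-- Finitely many small dimensions may need more than one cell. The bound `K` depends on the domains
only, which keeps the final constant independent of `L`. -/
theorem exists_uniform_hasCells {D : (d : ℕ) → Set (E d)} (hD : IsCubes D ∨ IsSmallRadius D)
    (hDc : ∀ d : ℕ, 1 ≤ d → Convex ℝ (D d)) :
    ∃ K : ℕ, 1 ≤ K ∧ ∀ d, 1 ≤ d → ∃ k ≤ K, HasCells (D d) k (1 / 2 * √d) := by
  obtain ⟨d₀, hd₀⟩ := eventually_atTop.1 (eventually_hasCells hD hDc)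
  have h : ∀ d, ∃ k, 1 ≤ d → HasCells (D d) k (1 / 2 * √d) := fun d => by
    by_cases hd : 1 ≤ d
    · obtain ⟨ho, hv⟩ := isOpen_and_volume_eq_one hD hd
      have hne : (D d).Nonempty := nonempty_of_measure_ne_zero (by rw [hv]; simp)
      obtain ⟨k, hk⟩ := exists_hasCells hne
        (isBounded_of_convex_of_volume ho (hDc d hd) hne (by rw [hv]; simp))
        (R := 1 / 2 * √d) (by positivity)
      exact ⟨k, fun _ => hk⟩
    · exact ⟨0, fun h => absurd h hd⟩
  choose k hk using h
  refine ⟨1 + ∑ i ∈ Finset.range d₀, k i, by omega, fun d hd => ?_⟩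
  rcases lt_or_ge d d₀ with hlt | hge
  · refine ⟨k d, ?_, hk d hd⟩
    have := Finset.single_le_sum (f := k) (fun i _ => Nat.zero_le _) (Finset.mem_range.2 hlt)
    omega
  · exact ⟨1, by omega, hd₀ d hge⟩

/-! ### Upper bounds for the information complexity -/

/-- Taylor polynomials of the fixed degree `j` reach any fixed error for large `d` with `O(d^j)`
values, which no exponential lower bound survives. -/
theorem not_curse_of_tendsto {D : (d : ℕ) → Set (E d)} (hD : IsCubes D ∨ IsSmallRadius D)
    (hDc : ∀ d : ℕ, 1 ≤ d → Convex ℝ (D d)) {L : ℕ → ℕ → ℝ} (hL : PosBounds L) {j : ℕ}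
    (hj : Tendsto (fun d : ℕ => L j d * (d : ℝ) ^ (((j : ℝ) + 1) / 2)) atTop (𝓝 0)) :
    ¬ Curse D L := by
  rintro ⟨c, hc, ε, hε, γ, hγ, hfr⟩
  have h1 : ∀ᶠ d : ℕ in atTop, L j d * (d : ℝ) ^ (((j : ℝ) + 1) / 2) ≤ ε :=
    (hj.eventually_lt_const hε).mono fun _ h => h.le
  have h2 : ∀ᶠ d : ℕ in atTop, (d : ℝ) ^ j / (1 + γ) ^ d < c / (2 * 2 ^ j) :=
    (tendsto_pow_const_div_const_pow_of_one_lt j (by linarith : 1 < 1 + γ)).eventually_lt_const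
      (by positivity)
  obtain ⟨d, hd, ha, hb, hcell, hd1⟩ := (hfr.and_eventually (h1.and (h2.and
    ((eventually_hasCells hD hDc).and (eventually_ge_atTop 1))))).exists
  obtain ⟨ho, hv⟩ := isOpen_and_volume_eq_one hD hd1
  have hLj := hL j d hd1
  have hup := infoComplexity_smoothClass_le ho (hDc d hd1) hv hcell (L := fun i => L i d) (m := j)
    hLj.le (ε := ε) (by
      refine le_trans ?_ ha
      have hs : (d : ℝ) ^ (((j : ℝ) + 1) / 2) = √d ^ (j + 1) := by
        rw [Real.sqrt_eq_rpow, ← Real.rpow_natCast, ← Real.rpow_mul (by positivity)]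
        congr 1; push_cast; ring
      rw [hs, mul_pow]
      have hf : (1 : ℝ) ≤ j.factorial := by exact_mod_cast j.factorial_pos
      calc 2 * (L j d * ((1 / 2) ^ (j + 1) * √d ^ (j + 1)) / j.factorial)
          ≤ 2 * (L j d * ((1 / 2) ^ (j + 1) * √d ^ (j + 1)) / 1) := by gcongr
        _ = (1 / 2) ^ j * (L j d * √d ^ (j + 1)) := by rw [pow_succ]; ring
        _ ≤ 1 * (L j d * √d ^ (j + 1)) := by
          gcongr
          exact pow_le_one₀ (by norm_num) (by norm_num)
        _ = _ := one_mul _)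
  have h3 := (hd ε hε le_rfl).trans (ENat.toENNReal_le.2 hup)
  rw [ENat.toENNReal_coe, ← ENNReal.ofReal_natCast,
    ENNReal.ofReal_le_ofReal_iff (by positivity)] at h3
  have hd1' : (1 : ℝ) ≤ d := by exact_mod_cast hd1
  have h4 : ((1 * (d + 1) ^ j + 1 : ℕ) : ℝ) ≤ 2 * 2 ^ j * d ^ j := by
    push_cast
    have : ((d : ℝ) + 1) ^ j ≤ (2 * d) ^ j := by gcongr; linarith
    have h1 : (1 : ℝ) ≤ (2 * d) ^ j := one_le_pow₀ (by linarith)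
    rw [mul_assoc, ← mul_pow]; linarith
  rw [div_lt_div_iff₀ (by positivity) (by positivity)] at hb
  nlinarith

/-- With radius `√d / 2` the powers of `d` cancel and the error is at most `c θ^m`, `θ = 1 - δ/2`;
the degree `m` is then chosen of order `ln (c/ε) / ln (1/θ)`. -/
theorem quasiPolynomialBound_of_le {D : (d : ℕ) → Set (E d)} (hD : IsCubes D ∨ IsSmallRadius D)
    (hDc : ∀ d : ℕ, 1 ≤ d → Convex ℝ (D d)) (c δ : ℝ) (hδ : 0 < δ) :
    ∃ C : ℝ, ∀ L : ℕ → ℕ → ℝ, PosBounds L →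
      (∀ j d : ℕ, 1 ≤ j → 1 ≤ d →
        L j d ≤ c * (2 - δ) ^ j * (Nat.factorial j : ℝ) * (d : ℝ) ^ (-(((j : ℝ) + 1) / 2))) →
      QuasiPolynomialBound D L C := by
  obtain ⟨K, hK1, hK⟩ := exists_uniform_hasCells hD hDc
  have hK1' : (1 : ℝ) ≤ K := by exact_mod_cast hK1
  set θ := 1 - δ / 2 with hθ
  set l := -Real.log θ with hl
  refine ⟨Real.log (2 * K) + (|Real.log c| / l + 1 / l + 2), fun L hL hle d hd ε hε hε1 => ?_⟩
  -- The signs of `c` and `2 - δ` are read off from positive bounds: `c (2-δ)² > 0` gives `c > 0`,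
  -- and then `c (2-δ) > 0` gives `δ < 2`.
  have hj1 := (hL 1 1 le_rfl).trans_le (hle 1 1 le_rfl le_rfl)
  have hj2 := (hL 2 1 le_rfl).trans_le (hle 2 1 (by norm_num) le_rfl)
  norm_num at hj1 hj2
  have hc : 0 < c := by
    by_contra h
    nlinarith [sq_nonneg (2 - δ)]
  have hδ2 : 0 < 2 - δ := by
    by_contra h
    nlinarith
  have hθ0 : 0 < θ := by rw [hθ]; linarith
  have hθ1 : θ < 1 := by rw [hθ]; linarith
  have hl0 : 0 < l := by rw [hl]; linarith [Real.log_neg hθ0 hθ1]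
  have hlogε : Real.log ε < 0 := Real.log_neg hε hε1
  -- The `+ 1` ensures `m ≥ 1`, where the bound on `L` is available.
  set m := ⌈Real.log (c / ε) / l⌉₊ + 1 with hm
  have hm_le : (m : ℝ) ≤ (|Real.log c| / l + 1 / l + 2) * (1 - Real.log ε) := by
    have h1 : Real.log (c / ε) / l ≤ (|Real.log c| - Real.log ε) / l := by
      rw [Real.log_div hc.ne' hε.ne']
      gcongr
      exact le_abs_self _
    have h2 : (⌈Real.log (c / ε) / l⌉₊ : ℝ) ≤ (|Real.log c| - Real.log ε) / l + 1 := by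
      have h0 : 0 ≤ (|Real.log c| - Real.log ε) / l := by
        have := abs_nonneg (Real.log c)
        apply div_nonneg _ hl0.le; linarith
      refine le_trans ?_ (Nat.ceil_lt_add_one h0).le
      exact_mod_cast Nat.ceil_mono h1
    rw [hm]; push_cast
    have h3 : 0 ≤ |Real.log c| / l := by positivity
    have h4 : 0 ≤ 1 / l := by positivity
    have h5 : (|Real.log c| - Real.log ε) / l = |Real.log c| / l + 1 / l * (- Real.log ε) := by
      ring
    rw [h5] at h2
    nlinarith
  have hθm : c * θ ^ m ≤ ε := by
    have h1 : Real.log (c / ε) / l ≤ m := by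
      rw [hm]; push_cast
      exact (Nat.le_ceil _).trans (by linarith)
    rw [div_le_iff₀ hl0] at h1
    have h2 : Real.log (c * θ ^ m) ≤ Real.log ε := by
      rw [Real.log_mul hc.ne' (by positivity), Real.log_pow]
      rw [Real.log_div hc.ne' hε.ne', hl] at h1
      linarith
    exact (Real.log_le_log_iff (by positivity) hε).1 h2
  obtain ⟨k, hkK, hk⟩ := hK d hd
  obtain ⟨ho, hv⟩ := isOpen_and_volume_eq_one hD hd
  have hd0 : (0 : ℝ) < d := by exact_mod_cast hd
  have hd1 : (1 : ℝ) ≤ d := by exact_mod_cast hd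
  have hup := infoComplexity_smoothClass_le ho (hDc d hd) hv hk (L := fun i => L i d) (m := m)
    (hL m d hd).le (ε := ε) (by
      have hs : (d : ℝ) ^ (-(((m : ℝ) + 1) / 2)) * √d ^ (m + 1) = 1 := by
        rw [Real.sqrt_eq_rpow, ← Real.rpow_natCast, ← Real.rpow_mul (by positivity),
          ← Real.rpow_add hd0]
        convert Real.rpow_zero _ using 2
        push_cast; ring
      have h1 := hle m d (by omega) hd
      have hf : (0 : ℝ) < m.factorial := by exact_mod_cast m.factorial_pos
      calc 2 * (L m d * (1 / 2 * √d) ^ (m + 1) / m.factorial)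
          ≤ 2 * ((c * (2 - δ) ^ m * m.factorial * (d : ℝ) ^ (-(((m : ℝ) + 1) / 2))) *
            (1 / 2 * √d) ^ (m + 1) / m.factorial) := by gcongr
        _ = c * ((2 - δ) ^ m * (1 / 2) ^ m) * ((d : ℝ) ^ (-(((m : ℝ) + 1) / 2)) * √d ^ (m + 1)) := by
          rw [mul_pow, pow_succ (1 / 2 : ℝ)]
          field_simp
        _ = c * θ ^ m := by rw [hs, mul_one, ← mul_pow, hθ]; congr 2; ring
        _ ≤ ε := hθm)
  obtain ⟨N, hN⟩ := ENat.ne_top_iff_exists.1 (ne_top_of_le_ne_top (ENat.natCast_ne_top _) hup)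
  refine ⟨N, hN.symm, ?_⟩
  rw [← hN, Nat.cast_le] at hup
  have hlogd : 0 ≤ Real.log d := Real.log_nonneg hd1
  have hlogK : 0 ≤ Real.log (2 * K) := Real.log_nonneg (by linarith)
  have hNle : (N : ℝ) ≤ 2 * K * (d + 1) ^ m := by
    have h1 : (N : ℝ) ≤ k * (d + 1) ^ m + 1 := by exact_mod_cast hup
    have h2 : (k : ℝ) ≤ K := by exact_mod_cast hkK
    have h3 : (1 : ℝ) ≤ (d + 1) ^ m := one_le_pow₀ (by linarith)
    nlinarith
  have hlog : Real.log N ≤ Real.log (2 * K) + m * (1 + Real.log d) := by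
    rcases Nat.eq_zero_or_pos N with rfl | hN0
    · simp only [Nat.cast_zero, Real.log_zero]; positivity
    · have hd2 : Real.log (d + 1) ≤ 1 + Real.log d := by
        calc Real.log (d + 1) ≤ Real.log (2 * d) := Real.log_le_log (by linarith) (by linarith)
          _ = Real.log 2 + Real.log d := Real.log_mul (by norm_num) hd0.ne'
          _ ≤ _ := by linarith [Real.log_two_lt_d9]
      calc Real.log N ≤ Real.log (2 * K * (d + 1) ^ m) :=
            Real.log_le_log (by exact_mod_cast hN0) hNle
        _ = Real.log (2 * K) + m * Real.log (d + 1) := by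
          rw [Real.log_mul (by positivity) (by positivity), Real.log_pow]
        _ ≤ _ := by gcongr
  calc Real.log N ≤ Real.log (2 * K) + m * (1 + Real.log d) := hlog
    _ ≤ Real.log (2 * K) * (1 - Real.log ε) * (1 + Real.log d) +
        (|Real.log c| / l + 1 / l + 2) * (1 - Real.log ε) * (1 + Real.log d) := by
      gcongr
      rw [mul_assoc]
      exact le_mul_of_one_le_right hlogK (by nlinarith)
    _ = _ := by ring

/-! ### Smooth product kernels -/

theorem hasCompactSupport_sq {X : Type*} [TopologicalSpace X] {f : X → ℝ}
    (h : HasCompactSupport f) : HasCompactSupport fun x => f x ^ 2 := by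
  simp_rw [sq]
  exact HasCompactSupport.mul_right h

/-- An even smooth profile `q` on the line, supported in `[-ρ, ρ]`, such that `q²` is a probability
density; the `L²` norm of `q'` is at most `C / ρ`. -/
structure IsProfile (ρ C : ℝ) (q : ℝ → ℝ) : Prop where
  contDiff : ContDiff ℝ ∞ q
  even : ∀ t, q (-t) = q t
  eq_zero : ∀ t, ρ < |t| → q t = 0
  integral_sq : ∫ t, q t ^ 2 = 1
  integral_deriv_sq : ∫ t, deriv q t ^ 2 ≤ (C / ρ) ^ 2

theorem exists_isProfile : ∃ C > (0 : ℝ), ∀ ρ > 0, ∃ q, IsProfile ρ C q := by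
  let b : ContDiffBump (0 : ℝ) := ⟨1 / 2, 1, by norm_num, by norm_num⟩
  have hbc : ContDiff ℝ ∞ b := b.contDiff
  have hb1 : ContDiff ℝ 1 b := hbc.of_le (by exact_mod_cast le_top)
  set A := ∫ t, b t ^ 2 with hA
  set I := ∫ t, deriv b t ^ 2 with hI
  have hI0 : 0 ≤ I := integral_nonneg fun t => sq_nonneg _
  have hsupp : HasCompactSupport fun t => b t ^ 2 := hasCompactSupport_sq b.hasCompactSupport
  have hA0 : 0 < A := by
    refine Continuous.integral_pos_of_hasCompactSupport_nonneg_nonzero (x := 0)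
      (b.continuous.pow 2) hsupp (fun t => sq_nonneg _) ?_
    have := b.pos_of_mem_ball (x := 0) (by simpa using b.rOut_pos)
    positivity
  -- A bump rescaled to width `ρ` and normalized in `L²`: its derivative has `L²` norm `√(I/A) / ρ`.
  -- The `+ 1` makes the constant visibly positive.
  refine ⟨√(I / A) + 1, by positivity, fun ρ hρ => ⟨fun t => (√(ρ * A))⁻¹ * b (t / ρ), ?_⟩⟩
  have ha : (√(ρ * A))⁻¹ ^ 2 = (ρ * A)⁻¹ := by rw [inv_pow, Real.sq_sqrt (by positivity)]
  have hder : ∀ t, deriv (fun t => (√(ρ * A))⁻¹ * b (t / ρ)) t =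
      (√(ρ * A))⁻¹ * (deriv b (t / ρ) * ρ⁻¹) := fun t => by
    have h1 : HasDerivAt b (deriv b (t / ρ)) (t / ρ) :=
      ((hb1.differentiable (by simp)) _).hasDerivAt
    have h2 : HasDerivAt (fun t : ℝ => t / ρ) ρ⁻¹ t := by
      simpa [div_eq_mul_inv] using (hasDerivAt_id t).div_const ρ
    exact ((h1.comp t h2).const_mul _).deriv
  refine ⟨?_, ?_, ?_, ?_, ?_⟩
  · exact contDiff_const.mul (hbc.comp (contDiff_id.div_const _))
  · intro t
    simp only [neg_div, b.neg]
  · intro t ht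
    rw [b.zero_of_le_dist, mul_zero]
    simp only [dist_zero_right, norm_div, Real.norm_eq_abs, abs_of_pos hρ]
    rw [le_div_iff₀ hρ]; simpa [b] using ht.le
  · simp_rw [mul_pow, ha]
    rw [integral_const_mul, Measure.integral_comp_div (fun t => b t ^ 2) ρ, ← hA, abs_of_pos hρ]
    simp only [smul_eq_mul]
    field_simp
  · simp_rw [hder, mul_pow, ha]
    rw [integral_const_mul, integral_mul_const,
      Measure.integral_comp_div (fun t => deriv b t ^ 2) ρ, ← hI, abs_of_pos hρ, div_pow]
    have h1 : I / A ≤ (√(I / A) + 1) ^ 2 := by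
      have h0 : 0 ≤ I / A := by positivity
      nlinarith [Real.sq_sqrt h0, Real.sqrt_nonneg (I / A)]
    calc (ρ * A)⁻¹ * (ρ • I * ρ⁻¹ ^ 2) = I / A / ρ ^ 2 := by
          simp only [smul_eq_mul]; field_simp
      _ ≤ _ := by gcongr

namespace IsProfile

variable {ρ C : ℝ} {q : ℝ → ℝ}

theorem hasCompactSupport (h : IsProfile ρ C q) : HasCompactSupport q :=
  HasCompactSupport.intro (isCompact_closedBall (0 : ℝ) ρ) fun t ht => h.eq_zero t (by
    simpa using ht)

theorem continuous_deriv (h : IsProfile ρ C q) : Continuous (deriv q) :=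
  h.contDiff.continuous_deriv (by simp)

theorem hasDerivAt (h : IsProfile ρ C q) (t : ℝ) : HasDerivAt q (deriv q t) t :=
  ((h.contDiff.differentiable (by simp)) t).hasDerivAt

/-- The integrand is half the derivative of the compactly supported `q²`. This makes different
partial derivatives of the product profile orthogonal. -/
theorem integral_deriv_mul_self (h : IsProfile ρ C q) : ∫ t, deriv q t * q t = 0 := by
  have hc : Continuous fun t => deriv q t * q t := h.continuous_deriv.mul h.contDiff.continuous
  have hi : Integrable fun t => deriv q t * q t :=
    hc.integrable_of_hasCompactSupport h.hasCompactSupport.mul_left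
  have hd : ∀ t, HasDerivAt (fun t => q t ^ 2) (2 * (deriv q t * q t)) t := fun t => by
    have := (h.hasDerivAt t).fun_pow 2
    convert! this using 1
    simp; ring
  have h0 := integral_eq_zero_of_hasDerivAt_of_integrable hd (hi.const_mul 2)
    ((h.contDiff.continuous.pow 2).integrable_of_hasCompactSupport
      (hasCompactSupport_sq h.hasCompactSupport))
  rw [integral_const_mul] at h0
  linarith

end IsProfile

theorem integral_prod_coord {d : ℕ} (f : Fin d → ℝ → ℝ) :
    ∫ u : E d, ∏ k, f k (u k) = ∏ k, ∫ t, f k t := by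
  rw [← integral_fintype_prod_volume_eq_prod, ← (PiLp.volume_preserving_toLp (Fin d)).integral_comp
    (MeasurableEquiv.toLp 2 _).measurableEmbedding]

/-- The product `∏ q(u_i)`. -/
def productProfile (d : ℕ) (q : ℝ → ℝ) (u : E d) : ℝ := ∏ k, q (u k)

/-- The product probability density `∏ q(u_i)²`. -/
def kernel (d : ℕ) (q : ℝ → ℝ) (u : E d) : ℝ := productProfile d q u ^ 2

section Kernel

variable {d : ℕ} {ρ C : ℝ} {q : ℝ → ℝ}

theorem contDiff_productProfile (h : IsProfile ρ C q) : ContDiff ℝ ∞ (productProfile d q) :=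
  contDiff_prod fun i _ => h.contDiff.comp (by fun_prop)

theorem contDiff_kernel (h : IsProfile ρ C q) : ContDiff ℝ ∞ (kernel d q) :=
  (contDiff_productProfile h).pow 2

theorem kernel_nonneg (u : E d) : 0 ≤ kernel d q u := sq_nonneg _

theorem kernel_neg (h : IsProfile ρ C q) (u : E d) : kernel d q (-u) = kernel d q u := by
  simp [kernel, productProfile, h.even]

/-- The support lies in the cube `[-ρ, ρ]^d`, hence in the ball of radius `ρ √d`. -/
theorem productProfile_eq_zero (h : IsProfile ρ C q) (hρ : 0 ≤ ρ) {u : E d}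
    (hu : ρ * √d < ‖u‖) : productProfile d q u = 0 := by
  by_contra hne
  have h1 : ∀ k, |u k| ≤ ρ := fun k => by
    by_contra hk
    exact hne (Finset.prod_eq_zero (Finset.mem_univ k) (h.eq_zero _ (not_le.1 hk)))
  refine absurd hu (not_lt.2 ?_)
  rw [EuclideanSpace.norm_eq, show ρ * √d = √(d * ρ ^ 2) by
    rw [Real.sqrt_mul (by positivity), Real.sqrt_sq hρ, mul_comm]]
  refine Real.sqrt_le_sqrt ?_
  calc _ ≤ ∑ _i : Fin d, ρ ^ 2 := Finset.sum_le_sum fun i _ => by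
        exact pow_le_pow_left₀ (norm_nonneg _) (h1 i) 2
    _ = _ := by simp

theorem kernel_eq_zero (h : IsProfile ρ C q) (hρ : 0 ≤ ρ) {u : E d}
    (hu : ρ * √d < ‖u‖) : kernel d q u = 0 := by
  rw [kernel, productProfile_eq_zero h hρ hu]; simp

theorem hasCompactSupport_productProfile (h : IsProfile ρ C q) (hρ : 0 ≤ ρ) :
    HasCompactSupport (productProfile d q) :=
  HasCompactSupport.intro (isCompact_closedBall (0 : E d) (ρ * √d)) fun u hu =>
    productProfile_eq_zero h hρ (by simpa using hu)

theorem hasCompactSupport_kernel (h : IsProfile ρ C q) (hρ : 0 ≤ ρ) :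
    HasCompactSupport (kernel d q) :=
  hasCompactSupport_sq (hasCompactSupport_productProfile h hρ)

theorem integral_kernel (h : IsProfile ρ C q) : ∫ u, kernel d q u = 1 := by
  simp_rw [kernel, productProfile, ← Finset.prod_pow]
  rw [integral_prod_coord (fun _ t => q t ^ 2)]
  simp [h.integral_sq]

/-- The partial derivatives of `productProfile`. -/
def partialProfile (d : ℕ) (q : ℝ → ℝ) (i : Fin d) (u : E d) : ℝ :=
  ∏ k, (if k = i then deriv q else q) (u k)

theorem continuous_partialProfile (h : IsProfile ρ C q) (i : Fin d) :
    Continuous (partialProfile d q i) := by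
  refine continuous_finsetProd _ fun k _ => ?_
  split_ifs
  · exact h.continuous_deriv.comp (by fun_prop)
  · exact h.contDiff.continuous.comp (by fun_prop)

theorem fderiv_productProfile (h : IsProfile ρ C q) (u v : E d) :
    fderiv ℝ (productProfile d q) u v = ∑ i, v i * partialProfile d q i u := by
  have h1 : ∀ i ∈ (Finset.univ : Finset (Fin d)), HasFDerivAt (fun u : E d => q (u i))
      (deriv q (u i) • (EuclideanSpace.proj i : E d →L[ℝ] ℝ)) u := fun i _ =>
    (h.hasDerivAt (u i)).comp_hasFDerivAt u (EuclideanSpace.proj (𝕜 := ℝ) i).hasFDerivAt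
  have h2 := HasFDerivAt.finsetProd h1
  change fderiv ℝ (fun u : E d => ∏ k, q (u k)) u v = _
  rw [h2.fderiv]
  simp only [FunLike.coe_sum, Finset.sum_apply, FunLike.coe_smul, Pi.smul_apply, smul_eq_mul]
  refine Finset.sum_congr rfl fun i _ => ?_
  rw [partialProfile, ← Finset.mul_prod_erase _ _ (Finset.mem_univ i)]
  have h3 : ∏ k ∈ Finset.univ.erase i, (if k = i then deriv q else q) (u k) =
      ∏ k ∈ Finset.univ.erase i, q (u k) :=
    Finset.prod_congr rfl fun k hk => by rw [if_neg (Finset.ne_of_mem_erase hk)]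
  rw [h3]
  simp; ring

theorem integral_partialProfile_mul (h : IsProfile ρ C q) (i l : Fin d) :
    ∫ u, partialProfile d q i u * partialProfile d q l u =
      if i = l then ∫ t, deriv q t ^ 2 else 0 := by
  simp_rw [partialProfile, ← Finset.prod_mul_distrib]
  rw [integral_prod_coord (fun k t => (if k = i then deriv q else q) t *
    (if k = l then deriv q else q) t)]
  split_ifs with hil
  · subst hil
    rw [Finset.prod_eq_single i]
    · simp [sq]
    · intro k _ hk
      simp only [if_neg hk, ← sq, h.integral_sq]
    · simp
  · refine Finset.prod_eq_zero (Finset.mem_univ i) ?_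
    simp only [if_true, if_neg hil, h.integral_deriv_mul_self]

theorem fderiv_kernel (h : IsProfile ρ C q) (u v : E d) :
    fderiv ℝ (kernel d q) u v =
      2 * productProfile d q u * fderiv ℝ (productProfile d q) u v := by
  have h1 : HasFDerivAt (productProfile d q) (fderiv ℝ (productProfile d q) u) u :=
    (((contDiff_productProfile h).differentiable (by simp)) u).hasFDerivAt
  have h2 := h1.pow 2
  change fderiv ℝ (fun u => productProfile d q u ^ 2) u v = _
  rw [h2.fderiv]
  simp

theorem continuous_fderiv_productProfile (h : IsProfile ρ C q) (v : E d) :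
    Continuous fun u => fderiv ℝ (productProfile d q) u v :=
  ((contDiff_productProfile h).continuous_fderiv (by simp)).clm_apply continuous_const

theorem hasCompactSupport_fderiv_productProfile (h : IsProfile ρ C q) (hρ : 0 ≤ ρ) (v : E d) :
    HasCompactSupport fun u => fderiv ℝ (productProfile d q) u v :=
  (hasCompactSupport_productProfile h hρ).fderiv_apply ℝ v

theorem hasCompactSupport_partialProfile (h : IsProfile ρ C q) (hρ : 0 ≤ ρ) (i : Fin d) :
    HasCompactSupport (partialProfile d q i) := by
  have := hasCompactSupport_fderiv_productProfile h hρ (EuclideanSpace.single i 1 : E d)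
  simpa [fderiv_productProfile h, Pi.single_apply] using this

/-- By orthogonality the cross terms vanish and `(∑ v_i²) ∫ q'²` remains: this is where the
dimension drops out. -/
theorem integral_sq_fderiv_productProfile (h : IsProfile ρ C q) (hρ : 0 ≤ ρ) (v : E d) :
    ∫ u, (fderiv ℝ (productProfile d q) u v) ^ 2 ≤ (C / ρ * ‖v‖) ^ 2 := by
  have hint : ∀ i l, Integrable fun u : E d =>
      v i * v l * (partialProfile d q i u * partialProfile d q l u) := fun i l =>
    (((continuous_partialProfile h i).mul
      (continuous_partialProfile h l)).integrable_of_hasCompactSupport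
      (hasCompactSupport_partialProfile h hρ i).mul_right).const_mul _
  have h1 : ∀ u, (fderiv ℝ (productProfile d q) u v) ^ 2 =
      ∑ i, ∑ l, v i * v l * (partialProfile d q i u * partialProfile d q l u) := fun u => by
    rw [fderiv_productProfile h, sq, Finset.sum_mul_sum]
    exact Finset.sum_congr rfl fun i _ => Finset.sum_congr rfl fun l _ => by ring
  simp_rw [h1]
  rw [integral_finsetSum _ fun i _ => integrable_finsetSum _ fun l _ => hint i l]
  simp_rw [integral_finsetSum _ fun l _ => hint _ l, integral_const_mul,
    integral_partialProfile_mul h]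
  simp only [mul_ite, mul_zero, Finset.sum_ite_eq, Finset.mem_univ, if_true]
  rw [← Finset.sum_mul, mul_pow, EuclideanSpace.real_norm_sq_eq, mul_comm]
  simp_rw [← sq]
  exact mul_le_mul_of_nonneg_right h.integral_deriv_sq (Finset.sum_nonneg fun _ _ => sq_nonneg _)

/-- The `L¹` norm of a directional derivative of the kernel is bounded independently of the
dimension. -/
theorem integral_abs_fderiv_kernel_le (h : IsProfile ρ C q) (hρ : 0 < ρ) (hC : 0 < C) (v : E d) :
    ∫ u, |fderiv ℝ (kernel d q) u v| ≤ 2 * C / ρ * ‖v‖ := by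
  rcases eq_or_ne v 0 with rfl | hv
  · simp
  -- Cauchy–Schwarz in the form `2ab ≤ l a² + b²/l`; this `l` balances the bounds of the two
  -- integrals.
  set l := C / ρ * ‖v‖ with hl
  have hl0 : 0 < l := by have := norm_pos_iff.2 hv; positivity
  have hk : Integrable (kernel d q) := (contDiff_kernel h).continuous.integrable_of_hasCompactSupport
    (hasCompactSupport_kernel h hρ.le)
  have hf : Integrable fun u => (fderiv ℝ (productProfile d q) u v) ^ 2 :=
    ((continuous_fderiv_productProfile h v).pow 2).integrable_of_hasCompactSupport
      (hasCompactSupport_sq (hasCompactSupport_fderiv_productProfile h hρ.le v))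
  calc ∫ u, |fderiv ℝ (kernel d q) u v|
      ≤ ∫ u, (l * kernel d q u + l⁻¹ * (fderiv ℝ (productProfile d q) u v) ^ 2) := by
        refine integral_mono_of_nonneg (Eventually.of_forall fun _ => abs_nonneg _)
          ((hk.const_mul _).add (hf.const_mul _)) (Eventually.of_forall fun u => ?_)
        simp only [fderiv_kernel h, kernel, abs_mul, abs_two]
        rw [← sq_abs (productProfile d q u), ← sq_abs (fderiv ℝ (productProfile d q) u v)]
        set a := |productProfile d q u|
        set b := |fderiv ℝ (productProfile d q) u v|
        have : l * a ^ 2 + l⁻¹ * b ^ 2 - 2 * a * b = l⁻¹ * (l * a - b) ^ 2 := by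
          field_simp; ring
        have h0 : 0 ≤ l⁻¹ * (l * a - b) ^ 2 := by positivity
        linarith
    _ = l * 1 + l⁻¹ * ∫ u, (fderiv ℝ (productProfile d q) u v) ^ 2 := by
        rw [integral_add (hk.const_mul _) (hf.const_mul _), integral_const_mul, integral_const_mul,
          integral_kernel h]
    _ ≤ l * 1 + l⁻¹ * l ^ 2 := by
        gcongr
        exact integral_sq_fderiv_productProfile h hρ.le v
    _ = 2 * C / ρ * ‖v‖ := by rw [sq, inv_mul_cancel_left₀ hl0.ne', hl]; ring

end Kernel

/-! ### Averages and their derivatives -/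

/-- The average of `g` with respect to the kernel of the profile `q`. -/
def smear {d : ℕ} (q : ℝ → ℝ) {F : Type*} [NormedAddCommGroup F] [NormedSpace ℝ F]
    (g : E d → F) (x : E d) : F :=
  ∫ u, kernel d q u • g (x - u)

section Smear

variable {d : ℕ} {ρ C : ℝ} {q : ℝ → ℝ} {F : Type*} [NormedAddCommGroup F] [NormedSpace ℝ F]

theorem smear_eq_convolution (g : E d → F) :
    smear q g = convolution (kernel d q) g (ContinuousLinearMap.lsmul ℝ ℝ) volume := rfl

theorem integrable_kernel_smul (h : IsProfile ρ C q) (hρ : 0 ≤ ρ) {g : E d → F}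
    (hg : LocallyIntegrable g) (x : E d) : Integrable fun u => kernel d q u • g (x - u) :=
  (hasCompactSupport_kernel h hρ).convolutionExists_left (ContinuousLinearMap.lsmul ℝ ℝ)
    (contDiff_kernel h).continuous hg x

theorem integrable_kernel (h : IsProfile ρ C q) (hρ : 0 ≤ ρ) : Integrable (kernel d q) :=
  (contDiff_kernel h).continuous.integrable_of_hasCompactSupport (hasCompactSupport_kernel h hρ)

theorem contDiff_smear [CompleteSpace F] (h : IsProfile ρ C q) (hρ : 0 ≤ ρ) {g : E d → F}
    (hg : LocallyIntegrable g) : ContDiff ℝ ∞ (smear q g) :=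
  (hasCompactSupport_kernel h hρ).contDiff_convolution_left (ContinuousLinearMap.lsmul ℝ ℝ)
    (contDiff_kernel h) hg

/-- The derivative of an average is the average of the derivative. -/
theorem fderiv_smear (h : IsProfile ρ C q) (hρ : 0 ≤ ρ) {g : E d → F} (hg : ContDiff ℝ 1 g) :
    fderiv ℝ (smear q g) = smear q (fderiv ℝ g) := by
  ext1 x
  have hc := hg.continuous_fderiv one_ne_zero
  -- This ball contains `y - u` for all `y` within `1` of `x` and all `u` in the support of the
  -- kernel.
  obtain ⟨M, hM⟩ := (isCompact_closedBall x (1 + ρ * √d)).exists_bound_of_continuousOn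
    hc.continuousOn
  refine (hasFDerivAt_integral_of_dominated_of_fderiv_le (Metric.ball_mem_nhds x one_pos)
    (F := fun x u => kernel d q u • g (x - u)) (bound := fun u => kernel d q u * M)
    (F' := fun x u => kernel d q u • fderiv ℝ g (x - u))
    (Eventually.of_forall fun y => ?_) ?_ ?_ ?_ ?_ ?_).fderiv
  · exact (integrable_kernel_smul h hρ hg.continuous.locallyIntegrable y).aestronglyMeasurable
  · exact integrable_kernel_smul h hρ hg.continuous.locallyIntegrable x
  · exact (integrable_kernel_smul h hρ hc.locallyIntegrable x).aestronglyMeasurable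
  · refine Eventually.of_forall fun u y hy => ?_
    rw [norm_smul, Real.norm_of_nonneg (kernel_nonneg u)]
    rcases le_or_gt ‖u‖ (ρ * √d) with hu | hu
    · refine mul_le_mul_of_nonneg_left (hM _ ?_) (kernel_nonneg u)
      rw [Metric.mem_ball, dist_eq_norm] at hy
      rw [Metric.mem_closedBall, dist_eq_norm]
      calc ‖y - u - x‖ = ‖(y - x) - u‖ := by congr 1; abel
        _ ≤ _ := (norm_sub_le _ _).trans (by linarith)
    · rw [kernel_eq_zero h hρ hu]; simp
  · exact (integrable_kernel h hρ).mul_const M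
  · refine Eventually.of_forall fun u y _ => HasFDerivAt.fun_const_smul ?_ _
    have h1 := (hg.differentiable one_ne_zero (y - u)).hasFDerivAt
    have h2 : HasFDerivAt (fun y => g (y - u))
        ((fderiv ℝ g (y - u)).comp (ContinuousLinearMap.id ℝ (E d))) y :=
      h1.comp y ((hasFDerivAt_id y).sub_const u)
    rwa [ContinuousLinearMap.comp_id] at h2

/-- Iterated derivatives are built from `fderiv` by currying isometries, which must be moved through
the average. -/
theorem smear_isometry {G : Type*} [NormedAddCommGroup G] [NormedSpace ℝ G] (A : F ≃ₗᵢ[ℝ] G)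
    (g : E d → F) : smear q (A ∘ g) = A ∘ smear q g := by
  ext1 x
  refine Eq.trans (integral_congr_ae (Eventually.of_forall fun u => ?_))
    (A.toContinuousLinearEquiv.integral_comp_comm fun u => kernel d q u • g (x - u))
  exact (map_smul A _ _).symm

theorem iteratedFDeriv_smear [CompleteSpace F] (h : IsProfile ρ C q) (hρ : 0 ≤ ρ) {g : E d → F}
    (hg : ContDiff ℝ ∞ g) (j : ℕ) :
    iteratedFDeriv ℝ j (smear q g) = smear q (iteratedFDeriv ℝ j g) := by
  induction j with
  | zero =>
    rw [iteratedFDeriv_zero_eq_comp, iteratedFDeriv_zero_eq_comp]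
    exact (smear_isometry _ _).symm
  | succ j ih =>
    have h1 : ContDiff ℝ 1 (iteratedFDeriv ℝ j g) :=
      hg.iteratedFDeriv_right (by exact_mod_cast le_top)
    rw [iteratedFDeriv_succ_eq_comp_left, ih, fderiv_smear h hρ h1,
      iteratedFDeriv_succ_eq_comp_left]
    exact (smear_isometry (F := E d →L[ℝ] ContinuousMultilinearMap ℝ (fun _ : Fin j => E d) F)
      (G := ContinuousMultilinearMap ℝ (fun _ : Fin (j + 1) => E d) F)
      (continuousMultilinearCurryLeftEquiv ℝ (fun _ : Fin (j + 1) => E d) F).symm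
      (fderiv ℝ (iteratedFDeriv ℝ j g))).symm

/-- Averaging a bounded function yields a function with a derivative that is bounded independently
of the dimension. -/
theorem norm_fderiv_smear_le [CompleteSpace F] (h : IsProfile ρ C q) (hρ : 0 < ρ) (hC : 0 < C)
    {g : E d → F} (hg : Continuous g) {M : ℝ} (hM : ∀ x, ‖g x‖ ≤ M) (x : E d) :
    ‖fderiv ℝ (smear q g) x‖ ≤ 2 * C / ρ * M := by
  have hM0 : 0 ≤ M := (norm_nonneg _).trans (hM 0)
  have hk1 : ContDiff ℝ 1 (kernel d q) := (contDiff_kernel h).of_le (by exact_mod_cast le_top)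
  -- The derivative falls on the kernel, as `g` is merely continuous and bounded.
  have hd := (hasCompactSupport_kernel h hρ.le).hasFDerivAt_convolution_left
    (ContinuousLinearMap.lsmul ℝ ℝ) hk1 hg.locallyIntegrable (μ := volume) x
  rw [smear_eq_convolution, hd.fderiv]
  refine ContinuousLinearMap.opNorm_le_bound _ (by positivity) fun v => ?_
  have hint := ((hasCompactSupport_kernel h hρ.le).fderiv ℝ).convolutionExists_left
    ((ContinuousLinearMap.lsmul ℝ ℝ).precompL (E d)) (hk1.continuous_fderiv one_ne_zero)
    hg.locallyIntegrable (μ := volume) x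
  rw [convolution, ContinuousLinearMap.integral_apply hint]
  simp only [ContinuousLinearMap.precompL_apply, ContinuousLinearMap.lsmul_apply]
  have hfi : Integrable fun u => |fderiv ℝ (kernel d q) u v| :=
    (((hk1.continuous_fderiv one_ne_zero).clm_apply
      continuous_const).integrable_of_hasCompactSupport
      ((hasCompactSupport_kernel h hρ.le).fderiv_apply ℝ v)).abs
  calc _ ≤ ∫ u, |fderiv ℝ (kernel d q) u v| * M := by
        refine norm_integral_le_of_norm_le (hfi.mul_const M) (Eventually.of_forall fun u => ?_)
        rw [norm_smul, Real.norm_eq_abs]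
        exact mul_le_mul_of_nonneg_left (hM _) (abs_nonneg _)
    _ = (∫ u, |fderiv ℝ (kernel d q) u v|) * M := integral_mul_const _ _
    _ ≤ (2 * C / ρ * ‖v‖) * M := by
        gcongr
        exact integral_abs_fderiv_kernel_le h hρ hC v
    _ = _ := by ring

theorem smear_mono (h : IsProfile ρ C q) (hρ : 0 ≤ ρ) {g₁ g₂ : E d → ℝ}
    (h₁ : LocallyIntegrable g₁) (h₂ : LocallyIntegrable g₂) (hle : ∀ x, g₁ x ≤ g₂ x) (x : E d) :
    smear q g₁ x ≤ smear q g₂ x :=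
  integral_mono (integrable_kernel_smul h hρ h₁ x) (integrable_kernel_smul h hρ h₂ x)
    fun u => mul_le_mul_of_nonneg_left (hle _) (kernel_nonneg u)

theorem smear_add_const (h : IsProfile ρ C q) (hρ : 0 ≤ ρ) {g : E d → ℝ}
    (hg : LocallyIntegrable g) (a : ℝ) (x : E d) :
    smear q (fun y => g y + a) x = smear q g x + a := by
  simp only [smear, smul_add]
  rw [integral_add (integrable_kernel_smul h hρ hg x) ((integrable_kernel h hρ).smul_const a),
    integral_smul_const, integral_kernel h, one_smul]

theorem smear_eq_zero (h : IsProfile ρ C q) (hρ : 0 ≤ ρ) {g : E d → ℝ} {x : E d}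
    (hg : ∀ y, ‖y - x‖ ≤ ρ * √d → g y = 0) : smear q g x = 0 := by
  refine integral_eq_zero_of_ae (Eventually.of_forall fun u => ?_)
  rcases le_or_gt ‖u‖ (ρ * √d) with hu | hu
  · simp [hg (x - u) (by simpa using hu)]
  · simp [kernel_eq_zero h hρ hu]

/-- `g` is convex and its second differences are at most those of `‖x‖²`. -/
def SecondDiffBounds (g : E d → ℝ) : Prop :=
  ∀ x v, 0 ≤ g (x + v) + g (x - v) - 2 * g x ∧ g (x + v) + g (x - v) - 2 * g x ≤ 2 * ‖v‖ ^ 2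

theorem SecondDiffBounds.smear (h : IsProfile ρ C q) (hρ : 0 ≤ ρ) {g : E d → ℝ}
    (hg : LocallyIntegrable g) (hs : SecondDiffBounds g) : SecondDiffBounds (smear q g) := by
  intro x v
  have i1 := integrable_kernel_smul h hρ hg (x + v)
  have i2 := integrable_kernel_smul h hρ hg (x - v)
  have i3 := (integrable_kernel_smul h hρ hg x).const_mul 2
  have he : HighDimIntegration.smear q g (x + v) + HighDimIntegration.smear q g (x - v) -
      2 * HighDimIntegration.smear q g x = ∫ u, kernel d q u *
        (g (x - u + v) + g (x - u - v) - 2 * g (x - u)) := by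
    simp only [HighDimIntegration.smear]
    have i12 : Integrable fun u => kernel d q u • g (x + v - u) + kernel d q u • g (x - v - u) :=
      i1.add i2
    rw [← integral_add i1 i2, ← integral_const_mul, ← integral_sub i12 i3]
    refine integral_congr_ae (Eventually.of_forall fun u => ?_)
    simp only [smul_eq_mul, show x + v - u = x - u + v by abel, show x - v - u = x - u - v by abel]
    ring
  rw [he]
  constructor
  · exact integral_nonneg fun u => mul_nonneg (kernel_nonneg u) (hs _ _).1
  · calc _ ≤ ∫ u, kernel d q u * (2 * ‖v‖ ^ 2) := by
          refine integral_mono_of_nonneg (Eventually.of_forall fun u =>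
            mul_nonneg (kernel_nonneg u) (hs _ _).1) ((integrable_kernel h hρ).mul_const _)
            (Eventually.of_forall fun u => mul_le_mul_of_nonneg_left (hs _ _).2 (kernel_nonneg u))
      _ = _ := by rw [integral_mul_const, integral_kernel h, one_mul]

/-- The kernel is even with total mass one, so averaging `g (x - u)` and `g (x + u)` gives the same
value. Bounds for second differences thus control the change of `g` from both sides. -/
theorem smear_sub_eq (h : IsProfile ρ C q) (hρ : 0 ≤ ρ) {g : E d → ℝ} (hg : LocallyIntegrable g)
    (x : E d) : smear q g x - g x =
      (∫ u, kernel d q u * (g (x + u) + g (x - u) - 2 * g x)) / 2 := by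
  have i1 := integrable_kernel_smul h hρ hg x
  have hcomp : (fun u => kernel d q u * g (x + u)) =
      (fun u => (fun u => kernel d q u • g (x - u)) (-u)) := by
    ext u; simp [kernel_neg h, sub_neg_eq_add]
  have i2 : Integrable fun u => kernel d q u * g (x + u) := by
    rw [hcomp]; exact i1.comp_neg
  have e2 : ∫ u, kernel d q u * g (x + u) = smear q g x := by
    rw [hcomp, integral_neg_eq_self (fun u => kernel d q u • g (x - u))]; rfl
  have i3 : Integrable fun u => kernel d q u * (2 * g x) := (integrable_kernel h hρ).mul_const _
  have e : ∫ u, kernel d q u * (g (x + u) + g (x - u) - 2 * g x) =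
      smear q g x + smear q g x - 2 * g x := by
    simp_rw [mul_sub, mul_add]
    simp only [smul_eq_mul] at i1
    have i12 : Integrable fun u => kernel d q u * g (x + u) + kernel d q u * g (x - u) := i2.add i1
    rw [integral_sub i12 i3, integral_add i2 i1, e2, integral_mul_const, integral_kernel h]
    simp [smear]
  rw [e]; ring

theorem le_smear (h : IsProfile ρ C q) (hρ : 0 ≤ ρ) {g : E d → ℝ} (hg : LocallyIntegrable g)
    (hs : SecondDiffBounds g) (x : E d) : g x ≤ smear q g x := by
  have h1 : 0 ≤ ∫ u, kernel d q u * (g (x + u) + g (x - u) - 2 * g x) :=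
    integral_nonneg fun u => mul_nonneg (kernel_nonneg u) (hs _ _).1
  linarith [smear_sub_eq h hρ hg x]

theorem smear_le (h : IsProfile ρ C q) (hρ : 0 ≤ ρ) {g : E d → ℝ} (hg : LocallyIntegrable g)
    (hs : SecondDiffBounds g) (x : E d) : smear q g x ≤ g x + ρ ^ 2 * d := by
  have h1 : ∫ u, kernel d q u * (g (x + u) + g (x - u) - 2 * g x) ≤
      ∫ u, kernel d q u * (2 * (ρ ^ 2 * d)) := by
    refine integral_mono_of_nonneg (Eventually.of_forall fun u =>
      mul_nonneg (kernel_nonneg u) (hs _ _).1) ((integrable_kernel h hρ).mul_const _)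
      (Eventually.of_forall fun u => ?_)
    rcases le_or_gt ‖u‖ (ρ * √d) with hu | hu
    · refine mul_le_mul_of_nonneg_left ((hs _ _).2.trans ?_) (kernel_nonneg u)
      have := pow_le_pow_left₀ (norm_nonneg _) hu 2
      rw [mul_pow, Real.sq_sqrt (by positivity)] at this
      linarith
    · simp [kernel_eq_zero h hρ hu]
  rw [integral_mul_const, integral_kernel h] at h1
  linarith [smear_sub_eq h hρ hg x]

end Smear

/-! ### Infinitely many averages -/

/-- The iterated average of `G` with respect to the kernels of the profiles `q k`, …,
`q (k + N - 1)`. -/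
def smearIter {d : ℕ} (q : ℕ → ℝ → ℝ) (G : E d → ℝ) : ℕ → ℕ → E d → ℝ
  | _, 0 => G
  | k, N + 1 => smear (q k) (smearIter q G (k + 1) N)

section SmearIter

variable {d : ℕ} {ρ : ℕ → ℝ} {C s : ℝ} {q : ℕ → ℝ → ℝ} {G : E d → ℝ}

theorem continuous_smearIter (h : ∀ k, IsProfile (ρ k) C (q k)) (hρ : ∀ k, 0 < ρ k)
    (hG : Continuous G) (k N : ℕ) : Continuous (smearIter q G k N) := by
  induction N generalizing k with
  | zero => exact hG
  | succ N ih => exact (contDiff_smear (h k) (hρ k).le (ih (k + 1)).locallyIntegrable).continuous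

theorem secondDiffBounds_smearIter (h : ∀ k, IsProfile (ρ k) C (q k)) (hρ : ∀ k, 0 < ρ k)
    (hG : Continuous G) (hs : SecondDiffBounds G) (k N : ℕ) :
    SecondDiffBounds (smearIter q G k N) := by
  induction N generalizing k with
  | zero => exact hs
  | succ N ih =>
    exact (ih (k + 1)).smear (h k) (hρ k).le
      (continuous_smearIter h hρ hG (k + 1) N).locallyIntegrable

/-- The new average acts innermost, directly on the convex function `G`, and the outer averages are
monotone. -/
theorem smearIter_le_succ (h : ∀ k, IsProfile (ρ k) C (q k)) (hρ : ∀ k, 0 < ρ k)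
    (hG : Continuous G) (hs : SecondDiffBounds G) (k N : ℕ) (x : E d) :
    smearIter q G k N x ≤ smearIter q G k (N + 1) x := by
  induction N generalizing k x with
  | zero => exact le_smear (h k) (hρ k).le hG.locallyIntegrable hs x
  | succ N ih =>
    exact smear_mono (h k) (hρ k).le
      (continuous_smearIter h hρ hG (k + 1) N).locallyIntegrable
      (continuous_smearIter h hρ hG (k + 1) (N + 1)).locallyIntegrable (ih (k + 1)) x

theorem smearIter_le (h : ∀ k, IsProfile (ρ k) C (q k)) (hρ : ∀ k, 0 < ρ k)
    (hG : Continuous G) (hs : SecondDiffBounds G) (k N : ℕ) (x : E d) :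
    smearIter q G k N x ≤ G x + (∑ i ∈ Finset.range N, ρ (k + i) ^ 2) * d := by
  induction N generalizing k x with
  | zero => simp [smearIter]
  | succ N ih =>
    calc smearIter q G k (N + 1) x
        ≤ smear (q k) (fun y => G y + (∑ i ∈ Finset.range N, ρ (k + 1 + i) ^ 2) * d) x :=
          smear_mono (h k) (hρ k).le (continuous_smearIter h hρ hG (k + 1) N).locallyIntegrable
            (hG.add continuous_const).locallyIntegrable (ih (k + 1)) x
      _ = smear (q k) G x + (∑ i ∈ Finset.range N, ρ (k + 1 + i) ^ 2) * d :=
          smear_add_const (h k) (hρ k).le hG.locallyIntegrable _ x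
      _ ≤ G x + ρ k ^ 2 * d + (∑ i ∈ Finset.range N, ρ (k + 1 + i) ^ 2) * d := by
          gcongr
          exact smear_le (h k) (hρ k).le hG.locallyIntegrable hs x
      _ = _ := by
          rw [Finset.sum_range_succ']
          simp only [add_zero, add_assoc, add_comm 1]
          ring

theorem smearIter_eq_zero (h : ∀ k, IsProfile (ρ k) C (q k)) (hρ : ∀ k, 0 < ρ k)
    (k N : ℕ) (x : E d)
    (hx : ∀ y, ‖y - x‖ ≤ (∑ i ∈ Finset.range N, ρ (k + i)) * √d → G y = 0) :
    smearIter q G k N x = 0 := by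
  induction N generalizing k x with
  | zero => exact hx x (by simp)
  | succ N ih =>
    refine smear_eq_zero (h k) (hρ k).le fun y hy => ih (k + 1) y fun z hz => hx z ?_
    rw [Finset.sum_range_succ', add_mul]
    simp only [add_zero]
    calc ‖z - x‖ = ‖(z - y) + (y - x)‖ := by congr 1; abel
      _ ≤ ‖z - y‖ + ‖y - x‖ := norm_add_le _ _
      _ ≤ _ := by
        refine add_le_add (hz.trans (le_of_eq ?_)) hy
        congr 1
        exact Finset.sum_congr rfl fun i _ => by congr 1; omega

/-- The infinite iterated averages of a function with bounded second differences. -/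
theorem exists_infinite_smear (h : ∀ k, IsProfile (ρ k) C (q k)) (hρ : ∀ k, 0 < ρ k)
    (hs : ∀ k N, ∑ i ∈ Finset.range N, ρ (k + i) ≤ s) (hG : Continuous G)
    (hG2 : SecondDiffBounds G) :
    ∃ f : ℕ → E d → ℝ, (∀ k, ContDiff ℝ ∞ (f k)) ∧ (∀ k, f k = smear (q k) (f (k + 1))) ∧
      (∀ k, SecondDiffBounds (f k)) ∧ (∀ k x, G x ≤ f k x) ∧
      ∀ x, (∀ y, ‖y - x‖ ≤ s * √d → G y = 0) → f 0 x = 0 := by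
  have hρs : ∀ k, ρ k ≤ s := fun k => by simpa using hs k 1
  have hs0 : 0 ≤ s := (hρ 0).le.trans (hρs 0)
  have hmono : ∀ k x, Monotone fun N => smearIter q G k N x := fun k x =>
    monotone_nat_of_le_succ fun N => smearIter_le_succ h hρ hG hG2 k N x
  have hbd : ∀ k N x, smearIter q G k N x ≤ G x + s ^ 2 * d := fun k N x => by
    refine (smearIter_le h hρ hG hG2 k N x).trans ?_
    gcongr
    calc ∑ i ∈ Finset.range N, ρ (k + i) ^ 2 ≤ ∑ i ∈ Finset.range N, s * ρ (k + i) :=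
          Finset.sum_le_sum fun i _ => by
            rw [sq]; exact mul_le_mul_of_nonneg_right (hρs _) (hρ _).le
      _ ≤ s ^ 2 := by
          rw [← Finset.mul_sum, sq]; exact mul_le_mul_of_nonneg_left (hs k N) hs0
  -- Monotone and bounded in `N`, so the supremum is a limit and no uniform convergence is needed.
  let f : ℕ → E d → ℝ := fun k x => ⨆ N, smearIter q G k N x
  have hlim : ∀ k x, Tendsto (fun N => smearIter q G k N x) atTop (𝓝 (f k x)) := fun k x =>
    tendsto_atTop_ciSup (hmono k x) ⟨G x + s ^ 2 * d, by rintro _ ⟨N, rfl⟩; exact hbd k N x⟩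
  have hGf : ∀ k x, G x ≤ f k x := fun k x => (hmono k x).ge_of_tendsto (hlim k x) 0
  have hfG : ∀ k x, f k x ≤ G x + s ^ 2 * d := fun k x =>
    le_of_tendsto' (hlim k x) fun N => hbd k N x
  have hab : ∀ {a b c : ℝ}, 0 ≤ c → a ≤ b → b ≤ a + c → ‖b‖ ≤ ‖|a| + c‖ := fun {a b c} hc h1 h2 => by
    rw [Real.norm_of_nonneg (by positivity : 0 ≤ |a| + c), Real.norm_eq_abs, abs_le]
    constructor <;> linarith [neg_abs_le a, le_abs_self a]
  have hc0 : 0 ≤ s ^ 2 * (d : ℝ) := by positivity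
  have hBc : Continuous fun x => |G x| + s ^ 2 * d := hG.abs.add continuous_const
  have hmeas : ∀ k, Measurable (f k) := fun k => measurable_of_tendsto_metrizable
    (fun N => (continuous_smearIter h hρ hG k N).measurable) (tendsto_pi_nhds.2 (hlim k))
  have hloc : ∀ k, LocallyIntegrable (f k) := fun k => hBc.locallyIntegrable.mono
    (hmeas k).aestronglyMeasurable (Eventually.of_forall fun x => hab hc0 (hGf k x) (hfG k x))
  have hrec : ∀ k, f k = smear (q k) (f (k + 1)) := fun k => by
    ext1 x
    refine tendsto_nhds_unique ((tendsto_add_atTop_iff_nat 1).2 (hlim k x)) ?_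
    refine tendsto_integral_of_dominated_convergence
      (fun u => kernel d (q k) u • (|G (x - u)| + s ^ 2 * d)) (fun N => ?_) ?_ (fun N => ?_) ?_
    · exact (integrable_kernel_smul (h k) (hρ k).le
        (continuous_smearIter h hρ hG (k + 1) N).locallyIntegrable x).aestronglyMeasurable
    · exact integrable_kernel_smul (h k) (hρ k).le hBc.locallyIntegrable x
    · refine Eventually.of_forall fun u => ?_
      rw [norm_smul, Real.norm_of_nonneg (kernel_nonneg u)]
      refine mul_le_mul_of_nonneg_left ?_ (kernel_nonneg u)
      have := hab hc0 (hmono (k + 1) (x - u) (Nat.zero_le N)) (hbd (k + 1) N (x - u))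
      rwa [Real.norm_of_nonneg (by positivity : 0 ≤ |smearIter q G (k + 1) 0 (x - u)| + s ^ 2 * d)]
        at this
    · exact Eventually.of_forall fun u => (hlim (k + 1) (x - u)).const_smul _
  refine ⟨f, fun k => ?_, hrec, fun k x v => ?_, hGf, fun x hx => ?_⟩
  -- One average of a locally integrable function is already smooth; the other averages serve the
  -- derivative bounds.
  · rw [hrec k]; exact contDiff_smear (h k) (hρ k).le (hloc (k + 1))
  · have hl := ((hlim k (x + v)).add (hlim k (x - v))).sub ((hlim k x).const_mul 2)
    exact ⟨ge_of_tendsto' hl fun N => (secondDiffBounds_smearIter h hρ hG hG2 k N x v).1,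
      le_of_tendsto' hl fun N => (secondDiffBounds_smearIter h hρ hG hG2 k N x v).2⟩
  · refine tendsto_nhds_unique (hlim 0 x) (tendsto_const_nhds.congr fun N => ?_)
    refine (smearIter_eq_zero h hρ 0 N x fun y hy => hx y (hy.trans ?_)).symm
    gcongr
    exact hs 0 N

end SmearIter

/-! ### Derivative bounds independent of the dimension -/

theorem natCast_le_infty (n : ℕ) : (n : WithTop ℕ∞) ≤ ∞ :=
  WithTop.coe_le_coe.2 (le_top : (n : ℕ∞) ≤ ⊤)

/-- The second difference quotients of a smooth function converge to the second derivative. -/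
theorem tendsto_second_difference {d : ℕ} {f : E d → ℝ} (hf : ContDiff ℝ ∞ f) (x v : E d) :
    Tendsto (fun t : ℝ => (f (x + t • v) + f (x - t • v) - 2 * f x) / t ^ 2) (𝓝[>] 0)
      (𝓝 (iteratedFDeriv ℝ 2 f x fun _ => v)) := by
  have key : ∀ v : E d, Tendsto (fun t : ℝ => (f (x + t • v) -
      (f x + t * iteratedFDeriv ℝ 1 f x (fun _ => v) +
        t ^ 2 / 2 * iteratedFDeriv ℝ 2 f x (fun _ => v))) / t ^ 2) (𝓝[>] 0) (𝓝 0) := fun v => by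
    have hcd : ContDiff ℝ ∞ fun t : ℝ => f (x + t • v) := hf.comp (by fun_prop)
    have h0 : ∀ k, iteratedDerivWithin k (fun t : ℝ => f (x + t • v)) (Set.Icc 0 1) 0 =
        iteratedFDeriv ℝ k f x (fun _ => v) := fun k => by
      rw [iteratedDerivWithin_comp_line isOpen_univ hf.contDiffOn (by simp) k 0 (by simp)]
      simp
    have ht := Real.taylor_tendsto (convex_Icc (0 : ℝ) 1) (by simp : (0 : ℝ) ∈ Set.Icc 0 1)
      (n := 2) (hcd.contDiffOn.of_le (natCast_le_infty 2))
    have ht' := ht.mono_left (nhdsWithin_mono 0 Set.Ioi_subset_Ici_self |>.trans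
      (nhdsWithin_Icc_eq_nhdsGE (zero_lt_one (α := ℝ))).ge)
    refine ht'.congr fun t => ?_
    rw [taylor_within_apply]
    simp only [h0, Finset.sum_range_succ, Finset.sum_range_zero, sub_zero, smul_eq_mul]
    simp only [iteratedFDeriv_zero_apply]
    norm_num
    ring
  -- The odd terms of the expansions along `v` and `-v` cancel.
  have h1 := ((key v).add (key (-v))).add_const (iteratedFDeriv ℝ 2 f x fun _ => v)
  simp only [add_zero, zero_add] at h1
  refine h1.congr' ?_
  filter_upwards [self_mem_nhdsWithin] with t ht
  have ht' : t ≠ 0 := (Set.mem_Ioi.1 ht).ne'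
  have e1 : (iteratedFDeriv ℝ 1 f x) (fun _ => -v) = -(iteratedFDeriv ℝ 1 f x fun _ => v) := by
    simp [iteratedFDeriv_one_apply]
  have e2 : (iteratedFDeriv ℝ 2 f x) (fun _ => -v) = iteratedFDeriv ℝ 2 f x fun _ => v := by
    simp [iteratedFDeriv_two_apply]
  rw [e1, e2, smul_neg, ← sub_eq_add_neg]
  field_simp
  ring

theorem SecondDiffBounds.norm_iteratedFDeriv_two_le {d : ℕ} {f : E d → ℝ} (hf : ContDiff ℝ ∞ f)
    (hs : SecondDiffBounds f) (x : E d) : ‖iteratedFDeriv ℝ 2 f x‖ ≤ 2 := by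
  have hb : ∀ v, 0 ≤ fderiv ℝ (fderiv ℝ f) x v v ∧
      fderiv ℝ (fderiv ℝ f) x v v ≤ 2 * ‖v‖ ^ 2 := fun v => by
    have hl := tendsto_second_difference hf x v
    simp only [iteratedFDeriv_two_apply] at hl
    constructor
    · exact ge_of_tendsto' hl fun t => div_nonneg (hs x (t • v)).1 (sq_nonneg t)
    · refine le_of_tendsto hl ?_
      filter_upwards [self_mem_nhdsWithin] with t ht
      have ht' : 0 < t := ht
      rw [div_le_iff₀ (by positivity)]
      have := (hs x (t • v)).2
      rw [norm_smul, mul_pow, Real.norm_eq_abs, sq_abs] at this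
      linarith
  have hsymm : ∀ v w, fderiv ℝ (fderiv ℝ f) x v w = fderiv ℝ (fderiv ℝ f) x w v := fun v w =>
    (hf.contDiffAt.isSymmSndFDerivAt (by
      rw [minSmoothness_of_isRCLikeNormedField]
      exact natCast_le_infty 2)) v w
  have hcs : ∀ v w, |fderiv ℝ (fderiv ℝ f) x v w| ≤ 2 * (‖v‖ * ‖w‖) := fun v w => by
    have h1 : ∀ t : ℝ, 0 ≤ fderiv ℝ (fderiv ℝ f) x w w * (t * t) +
        2 * fderiv ℝ (fderiv ℝ f) x v w * t + fderiv ℝ (fderiv ℝ f) x v v := fun t => by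
      have := (hb (v + t • w)).1
      simp only [map_add, map_smul, add_apply, smul_apply, smul_eq_mul, hsymm w v] at this
      linarith
    -- Cauchy–Schwarz for the positive semidefinite Hessian passes from the diagonal to the operator
    -- norm without loss.
    have h2 := discrim_le_zero h1
    rw [discrim] at h2
    refine abs_le_of_sq_le_sq ?_ (by positivity)
    have h3 : fderiv ℝ (fderiv ℝ f) x w w * fderiv ℝ (fderiv ℝ f) x v v ≤
        (2 * ‖w‖ ^ 2) * (2 * ‖v‖ ^ 2) :=
      mul_le_mul (hb w).2 (hb v).2 (hb v).1 (by positivity)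
    nlinarith
  refine ContinuousMultilinearMap.opNorm_le_bound (by norm_num) fun m => ?_
  rw [iteratedFDeriv_two_apply, Fin.prod_univ_two]
  exact hcs _ _

/-- Each averaging step yields one more derivative, bounded independently of the dimension. -/
theorem norm_iteratedFDeriv_infinite_smear_le {d : ℕ} {ρ : ℕ → ℝ} {C : ℝ} {q : ℕ → ℝ → ℝ}
    (h : ∀ k, IsProfile (ρ k) C (q k)) (hρ : ∀ k, 0 < ρ k) (hC : 0 < C) {f : ℕ → E d → ℝ}
    (hf : ∀ k, ContDiff ℝ ∞ (f k)) (hrec : ∀ k, f k = smear (q k) (f (k + 1)))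
    (hs : ∀ k, SecondDiffBounds (f k)) (j k : ℕ) (x : E d) :
    ‖iteratedFDeriv ℝ (j + 2) (f k) x‖ ≤ 2 * ∏ i ∈ Finset.range j, 2 * C / ρ (k + i) := by
  induction j generalizing k x with
  | zero => simpa using (hs k).norm_iteratedFDeriv_two_le (hf k) x
  | succ j ih =>
    rw [show j + 1 + 2 = (j + 2) + 1 by ring, ← norm_fderiv_iteratedFDeriv]
    conv_lhs => rw [hrec k]
    rw [iteratedFDeriv_smear (h k) (hρ k).le (hf (k + 1))]
    refine (norm_fderiv_smear_le (h k) (hρ k) hC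
      ((hf (k + 1)).continuous_iteratedFDeriv
        (natCast_le_infty _)) (ih (k + 1)) x).trans
      (le_of_eq ?_)
    rw [Finset.prod_range_succ']
    simp only [add_zero, add_assoc, add_comm 1]
    ring

theorem secondDiffBounds_infDist_sq {d : ℕ} {K : Set (E d)} (hK : IsClosed K) (hKc : Convex ℝ K)
    (hne : K.Nonempty) : SecondDiffBounds fun x => Metric.infDist x K ^ 2 := by
  have hle : ∀ x, ∀ p ∈ K, Metric.infDist x K ^ 2 ≤ ‖x - p‖ ^ 2 := fun x p hp =>
    pow_le_pow_left₀ Metric.infDist_nonneg (by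
      rw [← dist_eq_norm]; exact Metric.infDist_le_dist_of_mem hp) 2
  have hex : ∀ x, ∃ p ∈ K, Metric.infDist x K ^ 2 = ‖x - p‖ ^ 2 := fun x => by
    obtain ⟨p, hp, h⟩ := hK.exists_infDist_eq_dist hne x
    exact ⟨p, hp, by rw [h, dist_eq_norm]⟩
  have hpar : ∀ a b : E d, ‖a + b‖ ^ 2 + ‖a - b‖ ^ 2 = 2 * (‖a‖ ^ 2 + ‖b‖ ^ 2) := fun a b => by
    have := parallelogram_law_with_norm ℝ a b
    nlinarith
  intro x v
  constructor
  -- Convexity: the midpoint of the nearest points of `x ± v` lies in `K` and competes at `x`.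
  · obtain ⟨p, hp, hpe⟩ := hex (x + v)
    obtain ⟨r, hr, hre⟩ := hex (x - v)
    simp only [hpe, hre]
    have h1 := hle x _ (hKc hp hr (by norm_num : (0 : ℝ) ≤ 1 / 2) (by norm_num : (0 : ℝ) ≤ 1 / 2)
      (by norm_num))
    have h2 := hpar ((1 / 2 : ℝ) • (x + v - p)) ((1 / 2 : ℝ) • (x - v - r))
    have h3 : (1 / 2 : ℝ) • (x + v - p) + (1 / 2 : ℝ) • (x - v - r) =
        x - ((1 / 2 : ℝ) • p + (1 / 2 : ℝ) • r) := by module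
    rw [h3, norm_smul, norm_smul, mul_pow, mul_pow] at h2
    have h4 : ‖(1 / 2 : ℝ)‖ ^ 2 = 1 / 4 := by norm_num
    rw [h4] at h2
    nlinarith [sq_nonneg ‖(1 / 2 : ℝ) • (x + v - p) - (1 / 2 : ℝ) • (x - v - r)‖]
  -- Upper bound: the nearest point of `x` competes at both `x + v` and `x - v`.
  · obtain ⟨p, hp, hpe⟩ := hex x
    simp only [hpe]
    have h1 := hle (x + v) p hp
    have h2 := hle (x - v) p hp
    have h3 := hpar (x - p) v
    rw [show x - p + v = x + v - p by abel, show x - p - v = x - v - p by abel] at h3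
    linarith

/-! ### The fooling function -/

/-- A smooth nonnegative function that vanishes on a given finite set, is large away from its convex
hull and has derivatives that are bounded independently of the dimension. -/
theorem exists_fooling_function {d : ℕ} {ρ : ℕ → ℝ} {C s : ℝ} {q : ℕ → ℝ → ℝ}
    (h : ∀ k, IsProfile (ρ k) C (q k)) (hρ : ∀ k, 0 < ρ k) (hC : 0 < C)
    (hs : ∀ k N, ∑ i ∈ Finset.range N, ρ (k + i) ≤ s) {X : Set (E d)} (hX : X.Finite)
    (hne : X.Nonempty) :
    ∃ f : E d → ℝ, ContDiff ℝ ∞ f ∧ (∀ x ∈ X, f x = 0) ∧ (∀ x, 0 ≤ f x) ∧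
      (∀ j x, ‖iteratedFDeriv ℝ (j + 2) f x‖ ≤ 2 * ∏ i ∈ Finset.range j, 2 * C / ρ i) ∧
      ∀ x, 2 * s * √d ≤ Metric.infDist x (convexHull ℝ X) → s ^ 2 * d ≤ f x := by
  have hs0 : 0 ≤ s := (hρ 0).le.trans (by simpa using hs 0 1)
  set K := convexHull ℝ X with hK
  have hKcomp : IsCompact K := hX.isCompact_convexHull (𝕜 := ℝ)
  have hKne : K.Nonempty := hne.convexHull
  -- All averages together reach no farther than `s √d`, so thickening by this amount preserves the
  -- zeros on `X`.
  set K' := Metric.cthickening (s * √d) K with hK'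
  have hKK' : K ⊆ K' := Metric.self_subset_cthickening K
  obtain ⟨f, hf, hrec, hf2, hGf, hf0⟩ := exists_infinite_smear h hρ hs
    (G := fun x => Metric.infDist x K' ^ 2) ((Metric.continuous_infDist_pt K').pow 2)
    (secondDiffBounds_infDist_sq Metric.isClosed_cthickening ((convex_convexHull ℝ X).cthickening _)
      (hKne.mono hKK'))
  refine ⟨f 0, hf 0, fun x hx => hf0 x fun y hy => ?_, fun x => (sq_nonneg _).trans (hGf 0 x),
    fun j x => ?_, fun x hx => ?_⟩
  · have : y ∈ K' := Metric.mem_cthickening_of_dist_le y x _ K (subset_convexHull ℝ X hx)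
      (by rwa [dist_eq_norm])
    simp [Metric.infDist_zero_of_mem this]
  · simpa using norm_iteratedFDeriv_infinite_smear_le h hρ hC hf hrec hf2 j 0 x
  · refine le_trans ?_ (hGf 0 x)
    have h1 : s * √d ≤ Metric.infDist x K' := by
      refine (Metric.le_infDist (hKne.mono hKK')).2 fun {y} hy => ?_
      rw [hK', hKcomp.cthickening_eq_biUnion_closedBall (by positivity)] at hy
      obtain ⟨z, hz, hyz⟩ := Set.mem_iUnion₂.1 hy
      have h2 := Metric.infDist_le_dist_of_mem (x := x) hz
      have h3 := dist_triangle x y z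
      rw [Metric.mem_closedBall] at hyz
      linarith
    calc s ^ 2 * d = (s * √d) ^ 2 := by rw [mul_pow, Real.sq_sqrt (by positivity)]
      _ ≤ _ := pow_le_pow_left₀ (by positivity) h1 2

/-- The multiple `κ / d` of a function as in `exists_fooling_function` belongs to the class
`C^∞(L)` if `L` is large enough. -/
theorem smul_mem_smoothClass {d : ℕ} (hd : 1 ≤ d) {D : Set (E d)} {p : E d}
    (hp : ∀ x ∈ D, ‖x - p‖ ≤ 1 / 2 * √d) {f : E d → ℝ} (hf : ContDiff ℝ ∞ f)
    (hf0 : ∀ x, 0 ≤ f x) {x₁ : E d} (hx₁ : x₁ ∈ D) (hfx₁ : f x₁ = 0) {P : ℕ → ℝ} (hP : P 0 = 1)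
    (hfP : ∀ j x, ‖iteratedFDeriv ℝ (j + 2) f x‖ ≤ 2 * P j) {κ : ℝ} (hκ : 0 < κ)
    (hκ1 : 2 * κ ≤ 1) {L : ℕ → ℝ} (hL0 : 2 * κ ≤ L 0 * √d)
    (hL : ∀ j, 2 * κ * P j ≤ L (j + 1) * d) :
    (fun x => κ / d * f x) ∈ smoothClass D L := by
  have hd0 : (0 : ℝ) < d := by exact_mod_cast hd
  have hsd : √(d : ℝ) * √d = d := Real.mul_self_sqrt hd0.le
  have hsd0 : 0 < √(d : ℝ) := by positivity
  have hlip : ∀ j x y, ‖iteratedFDeriv ℝ (j + 1) f x - iteratedFDeriv ℝ (j + 1) f y‖ ≤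
      2 * P j * ‖x - y‖ := fun j x y =>
    convex_univ.norm_image_sub_le_of_norm_fderiv_le
      (fun z _ => (hf.differentiable_iteratedFDeriv
        (by exact_mod_cast ENat.natCast_lt_top (j + 1))) z)
      (fun z _ => by rw [norm_fderiv_iteratedFDeriv]; exact hfP j z) (Set.mem_univ y)
      (Set.mem_univ x)
  -- The gradient vanishes at the minimum `x₁` and has Lipschitz constant `2`. The estimate is made
  -- on the ball around `D`, because `D` need not be convex.
  have hgrad : ∀ x ∈ Metric.closedBall p (1 / 2 * √d), ‖fderiv ℝ f x‖ ≤ 2 * √d := fun x hx => by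
    have h0 : iteratedFDeriv ℝ 1 f x₁ = 0 := by
      have hmin : IsLocalMin f x₁ := Eventually.of_forall fun y => by rw [hfx₁]; exact hf0 y
      rw [← norm_eq_zero, norm_iteratedFDeriv_one, hmin.fderiv_eq_zero, norm_zero]
    have h1 := hlip 0 x x₁
    rw [zero_add, h0, sub_zero, norm_iteratedFDeriv_one, hP] at h1
    have h2 : ‖x - x₁‖ ≤ √d := by
      rw [Metric.mem_closedBall, dist_eq_norm] at hx
      calc ‖x - x₁‖ = ‖(x - p) - (x₁ - p)‖ := by congr 1; abel
        _ ≤ _ := (norm_sub_le _ _).trans (by linarith [hp x₁ hx₁])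
    linarith
  have hmem : ∀ x ∈ D, x ∈ Metric.closedBall p (1 / 2 * √d) := fun x hx => by
    rw [Metric.mem_closedBall, dist_eq_norm]; exact hp x hx
  have hlip0 : ∀ x ∈ D, ∀ y ∈ D, ‖f x - f y‖ ≤ 2 * √d * ‖x - y‖ := fun x hx y hy =>
    (convex_closedBall p _).norm_image_sub_le_of_norm_fderiv_le
      (fun z _ => (hf.differentiable (by simp)) z) hgrad (hmem y hy) (hmem x hx)
  have hκd : 0 < κ / d := by positivity
  have hit : ∀ j x, iteratedFDeriv ℝ j (fun x => κ / d * f x) x =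
      (κ / d) • iteratedFDeriv ℝ j f x := fun j x =>
    iteratedFDeriv_const_smul_apply (a := κ / d) (f := f) ((hf.of_le (natCast_le_infty j)).contDiffAt)
  refine ⟨(contDiff_const.mul hf).contDiffOn, fun x hx => ?_, fun j x hx y hy => ?_⟩
  · have h1 := hlip0 x hx x₁ hx₁
    rw [hfx₁, sub_zero, Real.norm_eq_abs] at h1
    have h2 : ‖x - x₁‖ ≤ √d := by
      calc ‖x - x₁‖ = ‖(x - p) - (x₁ - p)‖ := by congr 1; abel
        _ ≤ _ := (norm_sub_le _ _).trans (by linarith [hp x₁ hx₁, hp x hx])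
    rw [abs_mul, abs_of_pos hκd]
    calc κ / d * |f x| ≤ κ / d * (2 * √d * √d) := by
          gcongr
          exact h1.trans (by gcongr)
      _ = 2 * κ := by rw [mul_assoc 2, hsd]; field_simp
      _ ≤ 1 := hκ1
  · rw [hit, hit, ← smul_sub, norm_smul, Real.norm_of_nonneg hκd.le]
    rcases j with _ | j
    · have h1 := hlip0 x hx y hy
      have h2 : ‖iteratedFDeriv ℝ 0 f x - iteratedFDeriv ℝ 0 f y‖ = ‖f x - f y‖ := by
        rw [iteratedFDeriv_zero_eq_comp, Function.comp_apply, Function.comp_apply, ← map_sub,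
          LinearIsometryEquiv.norm_map]
      rw [h2]
      calc κ / d * ‖f x - f y‖ ≤ κ / d * (2 * √d * ‖x - y‖) := by gcongr
        _ = (2 * κ) / √d * ‖x - y‖ := by
          rw [div_mul_eq_mul_div, div_mul_eq_mul_div, div_eq_div_iff hd0.ne' hsd0.ne']
          linear_combination (2 * κ * ‖x - y‖) * hsd
        _ ≤ L 0 * ‖x - y‖ := by
          gcongr
          rwa [div_le_iff₀ hsd0]
    · calc κ / d * ‖iteratedFDeriv ℝ (j + 1) f x - iteratedFDeriv ℝ (j + 1) f y‖
          ≤ κ / d * (2 * P j * ‖x - y‖) := by gcongr; exact hlip j x y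
        _ = (2 * κ * P j) / d * ‖x - y‖ := by ring
        _ ≤ L (j + 1) * ‖x - y‖ := by
          gcongr
          rw [div_le_iff₀ hd0]; exact hL j

/-- There are summable radii for which the derivative bounds grow as slowly as `(n!)^(1+η)`. -/
theorem exists_radii {C s η : ℝ} (hC : 0 < C) (hs : 0 < s) (hη : 0 < η) :
    ∃ ρ : ℕ → ℝ, (∀ k, 0 < ρ k) ∧ (∀ k N, ∑ i ∈ Finset.range N, ρ (k + i) ≤ s) ∧
      ∃ M : ℝ, 0 < M ∧ ∀ n : ℕ, ∏ i ∈ Finset.range n, 2 * C / ρ i ≤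
        M * (n.factorial : ℝ) ^ (1 + η) := by
  -- Half of `η` is spent on summability; the other half absorbs the geometric factor `A ^ n`.
  let t : ℕ → ℝ := fun i => ((i : ℝ) + 1) ^ (-(1 + η / 2))
  have ht0 : ∀ i, 0 < t i := fun i => by positivity
  have htsum : Summable t := by
    have h1 : Summable fun n : ℕ => (n : ℝ) ^ (-(1 + η / 2)) :=
      Real.summable_nat_rpow.2 (by linarith)
    simpa [t] using (summable_nat_add_iff 1).2 h1
  set S := ∑' i, t i with hS
  have hS0 : 0 < S := htsum.tsum_pos (fun i => (ht0 i).le) 0 (ht0 0)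
  have htail : ∀ k N, ∑ i ∈ Finset.range N, t (k + i) ≤ S := fun k N => by
    have h1 : ∑ i ∈ Finset.range N, t (k + i) ≤ ∑ i ∈ Finset.range (k + N), t i := by
      rw [Finset.sum_range_add]
      exact le_add_of_nonneg_left (Finset.sum_nonneg fun i _ => (ht0 i).le)
    exact h1.trans (htsum.sum_le_tsum _ fun i _ => (ht0 i).le)
  set A := 2 * C / (s / S) with hA
  have hA0 : 0 < A := by positivity
  have hprod : ∀ n, ∏ i ∈ Finset.range n, 2 * C / (s / S * t i) =
      A ^ n * (n.factorial : ℝ) ^ (1 + η / 2) := fun n => by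
    induction n with
    | zero => simp
    | succ n ih =>
      rw [Finset.prod_range_succ, ih, Nat.factorial_succ, Nat.cast_mul,
        Real.mul_rpow (by positivity) (by positivity), pow_succ, hA]
      simp only [t]
      rw [Real.rpow_neg (by positivity)]
      push_cast
      field_simp
  obtain ⟨B, hB⟩ : ∃ B : ℝ, ∀ n : ℕ, (A ^ (2 / η)) ^ n / n.factorial ≤ B := by
    obtain ⟨B, hB⟩ := (FloorSemiring.tendsto_pow_div_factorial_atTop (A ^ (2 / η))).bddAbove_range
    exact ⟨B, fun n => hB ⟨n, rfl⟩⟩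
  have hB0 : 0 < B := lt_of_lt_of_le (by positivity) (hB 0)
  have hpow : ∀ n : ℕ, A ^ n ≤ B ^ (η / 2) * (n.factorial : ℝ) ^ (η / 2) := fun n => by
    have hf : (0 : ℝ) < n.factorial := by exact_mod_cast n.factorial_pos
    have h1 := hB n
    rw [div_le_iff₀ hf] at h1
    have h2 := Real.rpow_le_rpow (by positivity) h1 (by positivity : 0 ≤ η / 2)
    rw [Real.mul_rpow hB0.le hf.le] at h2
    convert h2 using 1
    rw [← Real.rpow_natCast, ← Real.rpow_natCast, ← Real.rpow_mul hA0.le, ← Real.rpow_mul hA0.le]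
    congr 1
    field_simp
  refine ⟨fun i => s / S * t i, fun k => by have := ht0 k; positivity, fun k N => ?_,
    B ^ (η / 2), by positivity, fun n => ?_⟩
  · rw [← Finset.mul_sum]
    calc s / S * _ ≤ s / S * S := by gcongr; exact htail k N
      _ = s := by field_simp
  · have hf : (0 : ℝ) < n.factorial := by exact_mod_cast n.factorial_pos
    rw [hprod]
    calc A ^ n * (n.factorial : ℝ) ^ (1 + η / 2)
        ≤ (B ^ (η / 2) * (n.factorial : ℝ) ^ (η / 2)) * (n.factorial : ℝ) ^ (1 + η / 2) := by
          gcongr; exact hpow n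
      _ = _ := by
        rw [mul_assoc, ← Real.rpow_add hf]
        congr 2; ring

/-! ### Volumes near balls with diameter `[p, v]` -/

/-- The points of `D` at distance at most `r` from the ball with diameter `[p, v]`. -/
def thalesSet {d : ℕ} (D : Set (E d)) (p v : E d) (r : ℝ) : Set (E d) :=
  {x ∈ D | ∃ z, ‖x - z‖ ≤ r ∧ ‖z - p‖ ^ 2 ≤ inner ℝ (z - p) (v - p)}

/-- The convex hull of a set is covered by the balls with diameters `[p, v]`, where `v` runs through
the set. -/
theorem exists_sq_norm_le_inner_of_mem_convexHull {d : ℕ} {X : Set (E d)} (p : E d) {z : E d}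
    (hz : z ∈ convexHull ℝ X) : ∃ v ∈ X, ‖z - p‖ ^ 2 ≤ inner ℝ (z - p) (v - p) := by
  by_contra! h
  -- Otherwise `X`, and with it the hull, lies in this open half-space, which misses `z`.
  have hc : Convex ℝ {w : E d | inner ℝ (z - p) w < ‖z - p‖ ^ 2 + inner ℝ (z - p) p} :=
    convex_halfSpace_lt (innerₛₗ ℝ (z - p)).isLinear _
  have hsub : X ⊆ {w : E d | inner ℝ (z - p) w < ‖z - p‖ ^ 2 + inner ℝ (z - p) p} := fun v hv => by
    have := h v hv
    rw [inner_sub_right] at this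
    simp only [Set.mem_ofPred_eq]; linarith
  have h1 := convexHull_min hsub hc hz
  simp only [Set.mem_ofPred_eq] at h1
  have h2 : inner ℝ (z - p) (z - p) = ‖z - p‖ ^ 2 := real_inner_self_eq_norm_sq _
  rw [inner_sub_right] at h2
  linarith

/-- A Chernoff bound for the volume of Euclidean balls. -/
theorem volume_closedBall_le {d : ℕ} {τ : ℝ} (hτ : 0 < τ) (x : E d) :
    volume (Metric.closedBall x (τ * √d)) ≤
      ENNReal.ofReal ((2 * τ / √(2 / (Real.pi * Real.exp 1))) ^ d) := by
  rw [Measure.addHaar_closedBall_center]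
  -- Markov's inequality for a Gaussian; with this `a` it equals `exp (-d/2)` on the sphere of
  -- radius `τ √d`.
  set a := 1 / (2 * τ ^ 2) with ha
  have ha0 : 0 < a := by positivity
  have hint : Integrable fun v : E d => Real.exp (-a * ‖v‖ ^ 2) := by
    have := GaussianFourier.integrable_cexp_neg_mul_sq_norm_add (V := E d) (b := (a : ℂ))
      (by simpa using ha0) 0 0
    have h2 := this.re
    refine h2.congr (Eventually.of_forall fun v => ?_)
    simp only [zero_mul, add_zero]
    rw [show -(a : ℂ) * (‖v‖ : ℂ) ^ 2 = ((-a * ‖v‖ ^ 2 : ℝ) : ℂ) by push_cast; ring]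
    exact Complex.exp_ofReal_re _
  have hmk := mul_meas_ge_le_integral_of_nonneg (μ := volume)
    (Eventually.of_forall fun v : E d => (Real.exp_pos (-a * ‖v‖ ^ 2)).le) hint
    (Real.exp (-(d / 2)))
  have hset : {v : E d | Real.exp (-(d / 2)) ≤ Real.exp (-a * ‖v‖ ^ 2)} =
      Metric.closedBall 0 (τ * √d) := by
    ext v
    rw [Set.mem_ofPred_eq, Real.exp_le_exp, mem_closedBall_zero_iff,
      ← abs_of_nonneg (norm_nonneg v), ← abs_of_nonneg (by positivity : 0 ≤ τ * √(d : ℝ)),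
      ← sq_le_sq, mul_pow, Real.sq_sqrt (by positivity), ha, abs_of_nonneg (norm_nonneg v)]
    rw [neg_mul, neg_le_neg_iff, one_div, inv_mul_le_iff₀ (by positivity)]
    constructor <;> intro h <;> linarith
  rw [hset, GaussianFourier.integral_rexp_neg_mul_sq_norm ha0, finrank_euclideanSpace,
    Fintype.card_fin] at hmk
  rw [← ENNReal.ofReal_toReal (measure_closedBall_lt_top (μ := volume)).ne]
  refine ENNReal.ofReal_le_ofReal ?_
  change volume.real _ ≤ _
  have hexp : Real.exp (-(d / 2)) = (Real.exp 1) ^ (-((d : ℝ) / 2)) := by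
    rw [Real.exp_one_rpow]
  have h1 : volume.real (Metric.closedBall (0 : E d) (τ * √d)) ≤
      (Real.exp 1) ^ ((d : ℝ) / 2) * (Real.pi / a) ^ ((d : ℝ) / 2) := by
    rw [hexp, Real.rpow_neg (by positivity), inv_mul_le_iff₀ (by positivity)] at hmk
    exact hmk
  refine h1.trans (le_of_eq ?_)
  rw [← Real.mul_rpow (by positivity) (by positivity)]
  have h2 : Real.exp 1 * (Real.pi / a) = (2 * τ / √(2 / (Real.pi * Real.exp 1))) ^ 2 := by
    rw [div_pow, Real.sq_sqrt (by positivity), ha]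
    field_simp
  rw [h2, ← Real.rpow_natCast, ← Real.rpow_natCast, ← Real.rpow_mul (by positivity)]
  congr 1
  push_cast; ring

/-- The ball with diameter `[p, v]` has radius at most `(ρ/2) √d`, half that of the ball around `D`;
enlarged by `r √d` it falls under the Chernoff bound. -/
theorem volume_thalesSet_le_of_radius {d : ℕ} {D : Set (E d)} {p v : E d} {ρ r : ℝ} (hρ : 0 ≤ ρ)
    (hr : 0 < r) (hv : ‖v - p‖ ≤ ρ * √d) :
    volume (thalesSet D p v (r * √d)) ≤
      ENNReal.ofReal (((ρ + 2 * r) / √(2 / (Real.pi * Real.exp 1))) ^ d) := by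
  have h : thalesSet D p v (r * √d) ⊆
      Metric.closedBall (p + (1 / 2 : ℝ) • (v - p)) ((ρ / 2 + r) * √d) := by
    rintro x ⟨-, z, hxz, hz⟩
    rw [Metric.mem_closedBall, dist_eq_norm]
    have h1 : ‖(z - p) - (1 / 2 : ℝ) • (v - p)‖ ≤ ρ / 2 * √d := by
      have h2 := norm_sub_sq_real (z - p) ((1 / 2 : ℝ) • (v - p))
      rw [inner_smul_right, norm_smul] at h2
      have h3 : ‖(1 / 2 : ℝ)‖ = 1 / 2 := by norm_num
      rw [h3] at h2
      refine abs_le_of_sq_le_sq ?_ (by positivity) |> (le_abs_self _).trans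
      nlinarith [norm_nonneg (v - p)]
    calc ‖x - (p + (1 / 2 : ℝ) • (v - p))‖
        = ‖(x - z) + ((z - p) - (1 / 2 : ℝ) • (v - p))‖ := by congr 1; abel
      _ ≤ r * √d + ρ / 2 * √d := (norm_add_le _ _).trans (add_le_add hxz h1)
      _ = _ := by ring
  refine (measure_mono h).trans ((volume_closedBall_le (by positivity) _).trans (le_of_eq ?_))
  congr 3; ring

/-- For `y = t - 1/2` use `exp a ≤ 1 + a + a²` with `|a| ≤ 1/12`. As `y` has mean `0` and variance
`1/12`, the integral is at most `1 + 1/144 - 1/72`. -/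
theorem integral_exp_le {w : ℝ} (hw : |w| ≤ 1 / 2) :
    ∫ t, (Set.Ioo (0 : ℝ) 1).indicator
      (fun t => Real.exp (-(((t - 1 / 2) ^ 2 - (t - 1 / 2) * w) / 6))) t ≤ 1 - 1 / 144 := by
  rw [integral_indicator measurableSet_Ioo, ← integral_Ioc_eq_integral_Ioo,
    ← intervalIntegral.integral_of_le zero_le_one]
  have hle : ∫ t in (0 : ℝ)..1, Real.exp (-(((t - 1 / 2) ^ 2 - (t - 1 / 2) * w) / 6)) ≤
      ∫ t in (0 : ℝ)..1, (1 + 1 / 144 - ((t - 1 / 2) ^ 2 - (t - 1 / 2) * w) / 6) := by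
    refine intervalIntegral.integral_mono_on zero_le_one
      (Continuous.intervalIntegrable (by fun_prop) _ _)
      (Continuous.intervalIntegrable (by fun_prop) _ _) fun t ht => ?_
    set y := t - 1 / 2 with hy
    have hy1 : |y| ≤ 1 / 2 := by rw [abs_le]; constructor <;> linarith [ht.1, ht.2]
    have h1 : |y ^ 2 - y * w| ≤ 1 / 2 := by
      have h2 : |y * w| ≤ 1 / 2 * (1 / 2) := by
        rw [abs_mul]; exact mul_le_mul hy1 hw (abs_nonneg _) (by norm_num)
      have h3 : |y ^ 2| ≤ 1 / 4 := by
        rw [abs_of_nonneg (sq_nonneg y), ← sq_abs]; nlinarith [abs_nonneg y]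
      exact (abs_sub _ _).trans (by linarith)
    have h4 : |-((y ^ 2 - y * w) / 6)| ≤ 1 / 12 := by
      rw [abs_neg, abs_div, abs_of_pos (by norm_num : (0 : ℝ) < 6)]; linarith
    have h5 := Real.abs_exp_sub_one_sub_id_le (h4.trans (by norm_num))
    have h6 : (-((y ^ 2 - y * w) / 6)) ^ 2 ≤ 1 / 144 := by
      rw [← sq_abs]; nlinarith [abs_nonneg (-((y ^ 2 - y * w) / 6))]
    have := (abs_le.1 h5).2
    linarith
  refine hle.trans (le_of_eq ?_)
  have hd : ∀ t ∈ Set.uIcc (0 : ℝ) 1, HasDerivAt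
      (fun t => (1 + 1 / 144) * t - ((t - 1 / 2) ^ 3 / 3 - (t - 1 / 2) ^ 2 / 2 * w) / 6)
      (1 + 1 / 144 - ((t - 1 / 2) ^ 2 - (t - 1 / 2) * w) / 6) t := fun t _ => by
    have h0 : HasDerivAt (fun t : ℝ => t - 1 / 2) 1 t := (hasDerivAt_id t).sub_const _
    convert! ((hasDerivAt_id t).const_mul (1 + 1 / 144 : ℝ)).sub
      (((((h0.pow 3).div_const 3)).sub (((h0.pow 2).div_const 2).mul_const w)).div_const 6) using 1
    simp
  rw [intervalIntegral.integral_eq_sub_of_hasDerivAt hd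
    (Continuous.intervalIntegrable (by fun_prop) _ _)]
  norm_num
  ring

/-- A Chernoff bound for the sum of the independent terms `y_k² - y_k w_k`, where `y = x - p` and `w
= v - p`: its expectation is `d/12`, but it is at most `3d/144` on the set in question. -/
theorem volume_thalesSet_unitCube_le {d : ℕ} {v : E d} (hv : v ∈ unitCube d) :
    volume (thalesSet (unitCube d) (cubeCenter d) v (1 / 144 * √d)) ≤
      ENNReal.ofReal (Real.exp (-(1 / 288)) ^ d) := by
  set p := cubeCenter d with hp
  set g : Fin d → ℝ → ℝ := fun k => (Set.Ioo (0 : ℝ) 1).indicator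
    (fun t => Real.exp (-(((t - 1 / 2) ^ 2 - (t - 1 / 2) * (v k - 1 / 2)) / 6))) with hg
  set F : E d → ℝ := fun x => ∏ k, g k (x k) with hF
  have hg0 : ∀ k t, 0 ≤ g k t := fun k t => Set.indicator_nonneg (fun _ _ => (Real.exp_pos _).le) t
  have hgint : ∀ k, Integrable (g k) := fun k => by
    rw [hg, integrable_indicator_iff measurableSet_Ioo]
    exact ((Continuous.integrableOn_Icc (by fun_prop)).mono_set Set.Ioo_subset_Icc_self)
  have hFint : Integrable F := by
    rw [← (PiLp.volume_preserving_toLp (Fin d)).integrable_comp_emb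
      (MeasurableEquiv.toLp 2 _).measurableEmbedding]
    exact Integrable.fintype_prod hgint
  have hFI : ∫ x, F x ≤ (1 - 1 / 144) ^ d := by
    rw [hF, integral_prod_coord]
    calc ∏ k, ∫ t, g k t ≤ ∏ _k : Fin d, (1 - 1 / 144 : ℝ) :=
          Finset.prod_le_prod (fun k _ => integral_nonneg (hg0 k)) fun k _ => integral_exp_le (by
            have := hv k
            rw [abs_le]; constructor <;> linarith [this.1, this.2])
      _ = _ := by simp
  have hsd : √(d : ℝ) * √d = d := Real.mul_self_sqrt (by positivity)
  have hsub : thalesSet (unitCube d) p v (1 / 144 * √d) ⊆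
      {x | Real.exp (-(d / 288)) ≤ F x} := by
    rintro x ⟨hx, z, hxz, hz⟩
    have hvp : ‖v - p‖ ≤ 1 / 2 * √d := norm_sub_cubeCenter_le hv
    have hzp : ‖z - p‖ ≤ 1 / 2 * √d := by
      have h1 := hz.trans (real_inner_le_norm _ _)
      rcases eq_or_lt_of_le (norm_nonneg (z - p)) with h0 | h0
      · rw [← h0]; positivity
      · have : ‖z - p‖ ≤ ‖v - p‖ := by
          rw [sq] at h1; exact le_of_mul_le_mul_left h1 h0
        exact this.trans hvp
    have e : x - p = (z - p) + (x - z) := by abel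
    have h1 : ‖x - p‖ ^ 2 - inner ℝ (x - p) (v - p) ≤ d * (3 / 144) := by
      rw [e, norm_add_sq_real, inner_add_left]
      have i1 := real_inner_le_norm (z - p) (x - z)
      have i2 := (abs_le.1 (abs_real_inner_le_norm (x - z) (v - p))).1
      have j1 : ‖z - p‖ * ‖x - z‖ ≤ (1 / 2 * √d) * (1 / 144 * √d) := by gcongr
      have j2 : ‖x - z‖ * ‖v - p‖ ≤ (1 / 144 * √d) * (1 / 2 * √d) := by gcongr
      have j3 : ‖x - z‖ ^ 2 ≤ (1 / 144 * √d) ^ 2 := by gcongr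
      nlinarith
    have h2 : ‖x - p‖ ^ 2 - inner ℝ (x - p) (v - p) =
        ∑ k, ((x k - 1 / 2) ^ 2 - (x k - 1 / 2) * (v k - 1 / 2)) := by
      rw [EuclideanSpace.real_norm_sq_eq, PiLp.inner_apply, ← Finset.sum_sub_distrib]
      refine Finset.sum_congr rfl fun k _ => ?_
      simp [hp, cubeCenter, mul_comm]
    have h3 : F x = Real.exp (-((‖x - p‖ ^ 2 - inner ℝ (x - p) (v - p)) / 6)) := by
      rw [h2, Finset.sum_div, ← Finset.sum_neg_distrib, Real.exp_sum]
      refine Finset.prod_congr rfl fun k _ => ?_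
      simp only [hg]
      rw [Set.indicator_of_mem (hx k)]
    rw [Set.mem_ofPred_eq, h3, Real.exp_le_exp]
    linarith
  have hmk := mul_meas_ge_le_integral_of_nonneg (μ := volume)
    (Eventually.of_forall fun x : E d => Finset.prod_nonneg fun k _ => hg0 k (x k)) hFint
    (Real.exp (-(d / 288)))
  have hfin : volume (thalesSet (unitCube d) p v (1 / 144 * √d)) ≠ ⊤ := by
    refine ne_top_of_le_ne_top (b := volume (unitCube d)) (by rw [volume_unitCube]; simp)
      (measure_mono fun x hx => hx.1)
  have hfin2 : volume {x | Real.exp (-(d / 288)) ≤ F x} ≠ ⊤ :=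
    (hFint.measure_ge_lt_top (Real.exp_pos _)).ne
  rw [← ENNReal.ofReal_toReal hfin]
  refine ENNReal.ofReal_le_ofReal ((ENNReal.toReal_mono hfin2 (measure_mono hsub)).trans ?_)
  have h1 : volume.real {x | Real.exp (-(d / 288)) ≤ F x} ≤
      Real.exp (d / 288) * (1 - 1 / 144) ^ d := by
    have h2 : Real.exp (d / 288) * Real.exp (-(d / 288)) = 1 := by rw [← Real.exp_add]; simp
    calc volume.real {x | Real.exp (-(d / 288)) ≤ F x} =
          Real.exp (d / 288) * (Real.exp (-(d / 288)) *
            volume.real {x | Real.exp (-(d / 288)) ≤ F x}) := by rw [← mul_assoc, h2, one_mul]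
      _ ≤ _ := mul_le_mul_of_nonneg_left (hmk.trans hFI) (Real.exp_pos _).le
  refine h1.trans ?_
  calc Real.exp (d / 288) * (1 - 1 / 144 : ℝ) ^ d
      ≤ Real.exp (d / 288) * Real.exp (-(1 / 144)) ^ d := by
        gcongr
        linarith [Real.add_one_le_exp (-(1 / 144) : ℝ)]
    _ = _ := by
        rw [← Real.exp_nat_mul, ← Real.exp_nat_mul, ← Real.exp_add]
        congr 1; ring

/-- The geometric property of the domains on which the lower bound rests: neighbourhoods of balls
with diameters `[p, v]` have exponentially small volume. -/
theorem exists_volume_thalesSet_le {D : (d : ℕ) → Set (E d)} (hD : IsCubes D ∨ IsSmallRadius D) :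
    ∃ r > (0 : ℝ), ∃ θ : ℝ, 0 < θ ∧ θ < 1 ∧ ∀ᶠ d in atTop, ∃ p : E d,
      (∀ x ∈ D d, ‖x - p‖ ≤ 1 / 2 * √d) ∧
        ∀ v ∈ D d, volume (thalesSet (D d) p v (r * √d)) ≤ ENNReal.ofReal (θ ^ d) := by
  rcases hD with h | h
  · refine ⟨1 / 144, by norm_num, Real.exp (-(1 / 288)), Real.exp_pos _,
      Real.exp_lt_one_iff.2 (by norm_num), ?_⟩
    filter_upwards [eventually_ge_atTop 1] with d hd
    rw [h d hd]
    exact ⟨cubeCenter d, fun x hx => norm_sub_cubeCenter_le hx,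
      fun v hv => volume_thalesSet_unitCube_le hv⟩
  · obtain ⟨ρ, hρ0, hρ, hev⟩ := h.exists_center
    set b := √(2 / (Real.pi * Real.exp 1)) with hb
    have hb0 : 0 < b := by positivity
    refine ⟨(b - ρ) / 4, by linarith, (ρ + 2 * ((b - ρ) / 4)) / b, ?_, ?_, ?_⟩
    · have : 0 < ρ + 2 * ((b - ρ) / 4) := by linarith
      positivity
    · rw [div_lt_one hb0]; linarith
    · filter_upwards [hev] with d ⟨p, hp⟩
      refine ⟨p, fun x hx => (hp x hx).trans ?_, fun v hv =>
        volume_thalesSet_le_of_radius hρ0 (by linarith) (hp v hv)⟩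
      have := hρ.trans sqrt_two_div_pi_mul_exp_lt
      gcongr

/-! ### The lower bound -/

/-- Zero answers make adaption void: the nodes become a fixed sequence. -/
theorem Algorithm.values_eq_replicate {d : ℕ} {D : Set (E d)} (A : Algorithm D) {f : E d → ℝ}
    {n : ℕ} (hf : ∀ i < n, f (A.node (List.replicate i 0)) = 0) :
    A.values f n = List.replicate n 0 := by
  induction n with
  | zero => rfl
  | succ n ih =>
    rw [Algorithm.values, ih fun i hi => hf i (by omega), hf n (by omega), List.replicate_succ']

theorem zero_mem_smoothClass {d : ℕ} {D : Set (E d)} {L : ℕ → ℝ} (hL : ∀ j, 0 ≤ L j) :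
    (fun _ => 0) ∈ smoothClass D L := by
  refine ⟨contDiffOn_const, fun _ _ => by simp, fun j x _ y _ => ?_⟩
  have h : ∀ z : E d, iteratedFDeriv ℝ j (fun _ : E d => (0 : ℝ)) z = 0 := fun z => by
    have := iteratedFDeriv_fun_zero (𝕜 := ℝ) (E := E d) (F := ℝ) (n := j)
    exact congrFun this z
  rw [h, h, sub_zero, norm_zero]
  exact mul_nonneg (hL j) (norm_nonneg _)

/-- If an algorithm has a small error on the class `C^∞(L)`, then it uses exponentially many function
values. -/
theorem one_lt_card_mul_of_error_le {d : ℕ} (hd : 1 ≤ d) {D : Set (E d)} (hDo : IsOpen D)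
    (hD : volume D = 1) {p : E d} (hp : ∀ x ∈ D, ‖x - p‖ ≤ 1 / 2 * √d) {s θ : ℝ}
    (hvol : ∀ v ∈ D, volume (thalesSet D p v (2 * s * √d)) ≤ ENNReal.ofReal θ)
    {ρ : ℕ → ℝ} {C : ℝ} {q : ℕ → ℝ → ℝ} (h : ∀ k, IsProfile (ρ k) C (q k)) (hρ : ∀ k, 0 < ρ k)
    (hC : 0 < C) (hs : ∀ k N, ∑ i ∈ Finset.range N, ρ (k + i) ≤ s) {κ : ℝ} (hκ : 0 < κ)
    (hκ1 : 2 * κ ≤ 1) {L : ℕ → ℝ} (hLpos : ∀ j, 0 ≤ L j) (hL0 : 2 * κ ≤ L 0 * √d)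
    (hL : ∀ j, 2 * κ * ∏ i ∈ Finset.range j, 2 * C / ρ i ≤ L (j + 1) * d) {ε : ℝ} (hε0 : 0 ≤ ε)
    (hε : ε < κ * s ^ 2 / 4) {n : ℕ} {A : Algorithm D}
    (hA : A.error n (smoothClass D L) ≤ ENNReal.ofReal ε) : 1 / 2 < (n + 1) * θ := by
  by_contra! hn
  have : IsProbabilityMeasure (volume.restrict D) := ⟨by simpa using hD⟩
  have hs0 : 0 ≤ s := (hρ 0).le.trans (by simpa using hs 0 1)
  have hd0 : (0 : ℝ) < d := by exact_mod_cast hd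
  let x : ℕ → E d := fun i => A.node (List.replicate i 0)
  have hx : ∀ i, x i ∈ D := fun i => A.node_mem _
  -- One point more than the algorithm uses, so that `X` is nonempty even for `n = 0`.
  set X := x '' (Finset.range (n + 1) : Finset ℕ) with hX
  have hXf : X.Finite := (Finset.finite_toSet _).image _
  have hx0 : x 0 ∈ X := ⟨0, by simp, rfl⟩
  obtain ⟨f, hf, hf0, hfpos, hfder, hfbig⟩ := exists_fooling_function h hρ hC hs hXf ⟨_, hx0⟩
  have hmem := smul_mem_smoothClass hd hp hf hfpos (hx 0) (hf0 _ hx0)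
    (P := fun j => ∏ i ∈ Finset.range j, 2 * C / ρ i) (by simp) hfder hκ hκ1 hL0 hL
  set g : E d → ℝ := fun y => κ / d * f y with hg
  have hgc : Continuous g := continuous_const.mul hf.continuous
  have happ : ∀ f' ∈ smoothClass D L, (∀ i < n, f' (x i) = 0) →
      |(∫ y in D, f' y) - A.output (List.replicate n 0)| ≤ ε := fun f' hf' h0 => by
    have h1 := (le_iSup₂ (f := fun f (_ : f ∈ smoothClass D L) =>
      ENNReal.ofReal |(∫ x in D, f x) - A.apply n f|) f' hf').trans hA
    rw [ENNReal.ofReal_le_ofReal_iff hε0, Algorithm.apply, A.values_eq_replicate h0] at h1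
    exact h1
  have h1 := happ g hmem fun i hi => by
    rw [hg]
    simp only
    rw [hf0 (x i) ⟨i, by simp; omega, rfl⟩, mul_zero]
  have h2 := happ _ (zero_mem_smoothClass hLpos) fun _ _ => rfl
  simp only [integral_zero, zero_sub, abs_neg] at h2
  -- The algorithm gives `g` and the zero function the same output.
  have hint : ∫ y in D, g y ≤ 2 * ε := by
    have := (abs_le.1 h1).2
    have := (abs_le.1 h2).2
    linarith
  have hmk := mul_meas_ge_le_integral_of_nonneg (μ := volume.restrict D)
    (Eventually.of_forall fun y : E d => (mul_nonneg (by positivity) (hfpos y) : 0 ≤ g y))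
    (integrableOn_of_mem_smoothClass hDo hD hmem) (κ * s ^ 2)
  set S := {y | κ * s ^ 2 ≤ g y} with hS
  have hSm : MeasurableSet S := (isClosed_le continuous_const hgc).measurableSet
  have hcompl : volume.restrict D Sᶜ ≤ ENNReal.ofReal (1 / 2) := by
    rw [Measure.restrict_apply hSm.compl]
    have hsub : Sᶜ ∩ D ⊆ ⋃ i ∈ Finset.range (n + 1), thalesSet D p (x i) (2 * s * √d) := by
      rintro y ⟨hyS, hyD⟩
      have hy1 : Metric.infDist y (convexHull ℝ X) < 2 * s * √d := by
        by_contra hle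
        refine hyS ?_
        have := hfbig y (not_lt.1 hle)
        calc κ * s ^ 2 = κ / d * (s ^ 2 * d) := by field_simp
          _ ≤ κ / d * f y := by gcongr
      obtain ⟨z, hz, hyz⟩ := (Metric.infDist_lt_iff (Set.Nonempty.convexHull ⟨_, hx0⟩)).1 hy1
      obtain ⟨v, ⟨i, hi, rfl⟩, hv⟩ := exists_sq_norm_le_inner_of_mem_convexHull p hz
      refine Set.mem_iUnion₂.2 ⟨i, by simpa using hi, hyD, z, ?_, hv⟩
      rw [← dist_eq_norm]; exact hyz.le
    calc volume (Sᶜ ∩ D) ≤ ∑ i ∈ Finset.range (n + 1), volume (thalesSet D p (x i) (2 * s * √d)) :=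
          (measure_mono hsub).trans (measure_biUnion_finset_le _ _)
      _ ≤ ∑ _i ∈ Finset.range (n + 1), ENNReal.ofReal θ :=
          Finset.sum_le_sum fun i _ => hvol _ (hx i)
      _ = ENNReal.ofReal ((n + 1) * θ) := by
          rw [Finset.sum_const, Finset.card_range, nsmul_eq_mul, ← ENNReal.ofReal_natCast,
            ← ENNReal.ofReal_mul (by positivity)]
          push_cast; rfl
      _ ≤ _ := ENNReal.ofReal_le_ofReal hn
  have hreal : (volume.restrict D).real Sᶜ ≤ 1 / 2 := by
    have := ENNReal.toReal_mono ENNReal.ofReal_ne_top hcompl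
    rwa [ENNReal.toReal_ofReal (by norm_num)] at this
  rw [probReal_compl_eq_one_sub hSm] at hreal
  have h3 : κ * s ^ 2 * (1 / 2) ≤ κ * s ^ 2 * (volume.restrict D).real S := by
    gcongr; linarith
  linarith

/-- The factor `κ` fits the fooling function into the class, uniformly in `d` and in the order of
the derivative; the base of the exponential is `θ⁻¹`. -/
theorem curse_of_le {D : (d : ℕ) → Set (E d)} (hD : IsCubes D ∨ IsSmallRadius D)
    {L : ℕ → ℕ → ℝ} (hL : PosBounds L) {c η : ℝ} (hc : 0 < c) (hη : 0 < η)
    (hfr : ∃ᶠ d : ℕ in atTop, c ≤ L 0 d * √d ∧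
      ∀ j : ℕ, 1 ≤ j → c * (Nat.factorial j : ℝ) ^ (1 + η) ≤ L j d * d) : Curse D L := by
  obtain ⟨C, hC, hq⟩ := exists_isProfile
  obtain ⟨r, hr, θ, hθ0, hθ1, hvol⟩ := exists_volume_thalesSet_le hD
  obtain ⟨ρ, hρ, hs, M, hM, hprod⟩ := exists_radii hC (half_pos hr) hη
  choose q hq using fun k => hq (ρ k) (hρ k)
  set κ := min (1 / 2) (min (c / 2) (c / (2 * M))) with hκ
  have hκ0 : 0 < κ := by positivity
  have hκ1 : κ ≤ 1 / 2 := min_le_left _ _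
  have hκ2 : κ ≤ c / 2 := (min_le_right _ _).trans (min_le_left _ _)
  have hκ3 : κ ≤ c / (2 * M) := (min_le_right _ _).trans (min_le_right _ _)
  have hinv : 1 < θ⁻¹ := (one_lt_inv₀ hθ0).2 hθ1
  refine ⟨1 / 4, by norm_num, κ * (r / 2) ^ 2 / 8, by positivity, θ⁻¹ - 1, by linarith, ?_⟩
  have hlarge : ∀ᶠ d : ℕ in atTop, 2 ≤ θ⁻¹ ^ d :=
    (tendsto_pow_atTop_atTop_of_one_lt hinv).eventually_ge_atTop 2
  refine (hfr.and_eventually (hvol.and (hlarge.and (eventually_ge_atTop 1)))).mono ?_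
  rintro d ⟨⟨hL0, hLj⟩, ⟨p, hp, hv⟩, hd2, hd1⟩ ε hε0 hε
  obtain ⟨ho, hvD⟩ := isOpen_and_volume_eq_one hD hd1
  have hLj' : ∀ j, 2 * κ * ∏ i ∈ Finset.range j, 2 * C / ρ i ≤ L (j + 1) d * d := fun j => by
    refine le_trans ?_ (hLj (j + 1) (by omega))
    rw [le_div_iff₀ (by positivity)] at hκ3
    calc 2 * κ * ∏ i ∈ Finset.range j, 2 * C / ρ i
        ≤ 2 * κ * (M * (j.factorial : ℝ) ^ (1 + η)) := by gcongr; exact hprod j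
      _ = (κ * (2 * M)) * (j.factorial : ℝ) ^ (1 + η) := by ring
      _ ≤ c * ((j + 1).factorial : ℝ) ^ (1 + η) := by
        gcongr
        exact Nat.le_succ j
  have hlow : ∀ m : ℕ, m * θ ^ d ≤ 1 / 2 → (m : ℕ∞) ≤ nSmooth D L d ε := fun m hm => by
    refine le_iInf₂ fun n hn => ?_
    obtain ⟨A, hA⟩ := hn
    have h1 := one_lt_card_mul_of_error_le hd1 ho hvD hp (s := r / 2) (θ := θ ^ d)
      (by rwa [mul_div_cancel₀ _ two_ne_zero]) hq hρ hC hs hκ0 (by linarith)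
      (fun j => (hL j d hd1).le) (by linarith) hLj' hε0.le
      (lt_of_le_of_lt hε (by
        have : 0 < κ * (r / 2) ^ 2 := by positivity
        linarith)) hA
    have h2 : (m : ℝ) < n + 1 := lt_of_mul_lt_mul_right (hm.trans_lt h1) (by positivity)
    have h3 : m < n + 1 := by exact_mod_cast h2
    exact_mod_cast Nat.lt_succ_iff.1 h3
  have hm := hlow ⌊θ⁻¹ ^ d / 2⌋₊ (by
    have h1 : (⌊θ⁻¹ ^ d / 2⌋₊ : ℝ) ≤ θ⁻¹ ^ d / 2 := Nat.floor_le (by positivity)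
    calc (⌊θ⁻¹ ^ d / 2⌋₊ : ℝ) * θ ^ d ≤ θ⁻¹ ^ d / 2 * θ ^ d := by gcongr
      _ = 1 / 2 := by rw [inv_pow]; field_simp)
  refine le_trans ?_ (ENat.toENNReal_le.2 hm)
  rw [ENat.toENNReal_coe, ← ENNReal.ofReal_natCast]
  refine ENNReal.ofReal_le_ofReal ?_
  rw [add_sub_cancel]
  have h1 := Nat.lt_floor_add_one (θ⁻¹ ^ d / 2)
  -- A floor that is at least `1` is at least half of its argument, whence the constant `1/4`.
  have h2 : (1 : ℝ) ≤ ⌊θ⁻¹ ^ d / 2⌋₊ := by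
    exact_mod_cast Nat.le_floor (by rw [Nat.cast_one]; linarith : ((1 : ℕ) : ℝ) ≤ θ⁻¹ ^ d / 2)
  linarith

end HighDimIntegration

end

theorem theorem6p1 (D : (d : ℕ) → Set (HighDimIntegration.E d))
    (hD : HighDimIntegration.IsCubes D ∨ HighDimIntegration.IsSmallRadius D) :
    (∀ L : ℕ → ℕ → ℝ, HighDimIntegration.PosBounds L →
      ∀ c η : ℝ, 0 < c → 0 < η →
        (∃ᶠ d : ℕ in atTop,
          c ≤ L 0 d * Real.sqrt d ∧
            ∀ j : ℕ, 1 ≤ j → c * (Nat.factorial j : ℝ) ^ (1 + η) ≤ L j d * d) →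
        HighDimIntegration.Curse D L) ∧
    ((∀ d : ℕ, 1 ≤ d → Convex ℝ (D d)) →
      (∀ L : ℕ → ℕ → ℝ, HighDimIntegration.PosBounds L →
        (∃ j : ℕ, Tendsto (fun d : ℕ => L j d * (d : ℝ) ^ (((j : ℝ) + 1) / 2)) atTop (𝓝 0)) →
        ¬ HighDimIntegration.Curse D L) ∧
      (∀ c δ : ℝ, 0 < δ → ∃ C : ℝ,
        ∀ L : ℕ → ℕ → ℝ, HighDimIntegration.PosBounds L →
          (∀ j d : ℕ, 1 ≤ j → 1 ≤ d →
            L j d ≤ c * (2 - δ) ^ j * (Nat.factorial j : ℝ) * (d : ℝ) ^ (-(((j : ℝ) + 1) / 2))) →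
          HighDimIntegration.QuasiPolynomialBound D L C)) := by
  exact ⟨fun L hL c η hc hη hfr => HighDimIntegration.curse_of_le hD hL hc hη hfr,
    fun hDc => ⟨fun L hL ⟨_, hj⟩ => HighDimIntegration.not_curse_of_tendsto hD hDc hL hj,
      fun c δ hδ => HighDimIntegration.quasiPolynomialBound_of_le hD hDc c δ hδ⟩⟩
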